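/- For a complex number $q$ with $|q|<1$ and $s\in\mathbb{C}$ let $L_q(s)=\sum_{n=1}^\infty \frac{n^s q^n}{1-q^n}$ be the Lambert series, let $B_n$ be the Bernoulli numbers, $\delta_{jk}$ the Kronecker delta, and $\theta=\cot^{-1}\sqrt7$. For every integer $k\ge 1$ put $$a_k=2^{2k}+2\cos[(4k-2)\theta],$$ $$b_k=2^{2k+1}+2^{-2k+2}+2^{3/2}\sin[(4k+1)\theta]+2\cos(4k\theta),$$ $$c_{jk}=\frac{2^{2k+\frac12-j}\cos[(2j-1)\theta]+2^{j+\frac12}\cos[(4k-1-2j)\theta]}{a_k(1+\delta_{jk})}\qquad(0\le j\le k).$$ Then $a_k\neq 0$, the three Lambert series below converge, and $$\zeta(4k-1)=(2\pi)^{4k-1}\sum_{j=0}^k\frac{(-1)^{j+1}c_{jk}B_{2j}B_{4k-2j}}{(2j)!\,(4k-2j)!}+\frac{b_k}{a_k}L_{e^{-\sqrt7\pi}}(-4k+1)-\frac{(2^{-4k+2}+2)b_k-2^{-2k+2}}{a_k}L_{e^{-2\sqrt7\pi}}(-4k+1)+\frac{2^{-4k+2}b_k}{a_k}L_{e^{-4\sqrt7\pi}}(-4k+1).$$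 Moreover, this converges faster than the classical formula $$\zeta(4k-1)=(2\pi)^{4k-1}\sum_{j=0}^k\frac{(-1)^{j+1}B_{2j}B_{4k-2j}}{(2j)!\,(4k-2j)!\,(1+\delta_{jk})}-2L_{e^{-2\pi}}(-4k+1)$$ in the following sense. Let $E_N$ (respectively $F_N$) be the absolute value of the difference between $\zeta(4k-1)$ and the right-hand side of the first (respectively second) formula with every Lambert series in it replaced by the sum of its first $N$ terms. Then, as $N\to\infty$, $E_N\to0$ and $F_N\to0$, both are nonzero for all large $N$, the number of decimal digits gained per additional term satisfies $$\log_{10}\frac{E_N}{E_{N+1}}\to\frac{\sqrt7\,\pi}{\log 10},\qquad \log_{10}\frac{F_N}{F_{N+1}}\to\frac{2\pi}{\log 10},$$ and $E_N/F_N\to0$. Numerically, $\left|\frac{\sqrt7\,\pi}{\log10}-3.6\right|<0.05$ and $\left|\frac{(\sqrt7-2)\pi}{\log10}-0.9\right|<0.05$. -/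

import Mathlib

open Filter Topology

/-- The `n`-th term `n ^ s * q ^ n / (1 - q ^ n)` of the Lambert series (`n ≥ 1`). -/
noncomputable def lambertTerm (q s : ℂ) (n : ℕ) : ℂ :=
  (n : ℂ) ^ s * q ^ n / (1 - q ^ n)

/-- The Lambert series `L_q(s) = ∑_{n ≥ 1} n ^ s * q ^ n / (1 - q ^ n)`, for `‖q‖ < 1`. -/
noncomputable def lambertSeries (q s : ℂ) : ℂ :=
  ∑' n : ℕ, lambertTerm q s (n + 1)

/-- The sum of the first `N` terms (`1 ≤ n ≤ N`) of the Lambert series. -/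
noncomputable def lambertPartial (N : ℕ) (q s : ℂ) : ℂ :=
  ∑ n ∈ Finset.range N, lambertTerm q s (n + 1)

/-- The inverse cotangent (the branch with values in `(0, π)`). -/
noncomputable def arccot (x : ℝ) : ℝ := Real.pi / 2 - Real.arctan x

/-- The angle `θ = arccot √7`. -/
noncomputable def theta7 : ℝ := arccot (Real.sqrt 7)

/-- `q = exp (-m √7 π)`. -/
noncomputable def nome7 (m : ℕ) : ℂ :=
  ((Real.exp (-((m : ℝ) * Real.sqrt 7 * Real.pi)) : ℝ) : ℂ)

/-- `a_k = 2^(2k) + 2 cos ((4k - 2) θ)`. -/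
noncomputable def coeffA (k : ℕ) : ℝ :=
  2 ^ (2 * k) + 2 * Real.cos ((4 * (k : ℝ) - 2) * theta7)

/-- `b_k = 2^(2k+1) + 2^(-2k+2) + 2^(3/2) sin ((4k + 1) θ) + 2 cos (4 k θ)`. -/
noncomputable def coeffB (k : ℕ) : ℝ :=
  2 ^ (2 * k + 1) + (2 : ℝ) ^ (-2 * (k : ℤ) + 2)
    + (2 : ℝ) ^ (3 / 2 : ℝ) * Real.sin ((4 * (k : ℝ) + 1) * theta7)
    + 2 * Real.cos (4 * (k : ℝ) * theta7)

/-- `c_{jk} = (2^(2k + 1/2 - j) cos ((2j - 1) θ) + 2^(j + 1/2) cos ((4k - 1 - 2j) θ))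
  / (a_k (1 + δ_{jk}))`. -/
noncomputable def coeffC (j k : ℕ) : ℝ :=
  ((2 : ℝ) ^ (2 * (k : ℝ) + 1 / 2 - (j : ℝ)) * Real.cos ((2 * (j : ℝ) - 1) * theta7)
    + (2 : ℝ) ^ ((j : ℝ) + 1 / 2) * Real.cos ((4 * (k : ℝ) - 1 - 2 * (j : ℝ)) * theta7))
    / (coeffA k * (1 + if j = k then 1 else 0))

/-- The right-hand side of the formula at `e^{-√7π}`, `e^{-2√7π}`, `e^{-4√7π}` with each of the
three Lambert series cut off after its first `N` terms. -/
noncomputable def root7Approx (k N : ℕ) : ℂ :=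
  (2 * (Real.pi : ℂ)) ^ (4 * k - 1) *
      ∑ j ∈ Finset.range (k + 1),
        (-1) ^ (j + 1) * (coeffC j k : ℂ) * (bernoulli (2 * j) : ℂ)
          * (bernoulli (4 * k - 2 * j) : ℂ)
          / (((2 * j).factorial : ℂ) * ((4 * k - 2 * j).factorial : ℂ))
    + ((coeffB k / coeffA k : ℝ) : ℂ) * lambertPartial N (nome7 1) (-4 * (k : ℂ) + 1)
    - (((((2 : ℝ) ^ (-4 * (k : ℤ) + 2) + 2) * coeffB k - (2 : ℝ) ^ (-2 * (k : ℤ) + 2))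
          / coeffA k : ℝ) : ℂ) * lambertPartial N (nome7 2) (-4 * (k : ℂ) + 1)
    + (((2 : ℝ) ^ (-4 * (k : ℤ) + 2) * coeffB k / coeffA k : ℝ) : ℂ)
        * lambertPartial N (nome7 4) (-4 * (k : ℂ) + 1)

/-- The right-hand side of the classical formula (the case `t = 1`)
`ζ(4k-1) = (2π)^(4k-1) ∑_{j ≤ k} (-1)^(j+1) B_{2j} B_{4k-2j} / ((2j)! (4k-2j)! (1 + δ_{jk}))
  - 2 L_{e^{-2π}}(-4k+1)`
with the Lambert series cut off after its first `N` terms. -/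
noncomputable def classicalApprox (k N : ℕ) : ℂ :=
  (2 * (Real.pi : ℂ)) ^ (4 * k - 1) *
      ∑ j ∈ Finset.range (k + 1),
        (-1) ^ (j + 1) * (bernoulli (2 * j) : ℂ) * (bernoulli (4 * k - 2 * j) : ℂ)
          / (((2 * j).factorial : ℂ) * ((4 * k - 2 * j).factorial : ℂ)
              * (1 + if j = k then 1 else 0))
    - 2 * lambertPartial N ((Real.exp (-(2 * Real.pi)) : ℝ) : ℂ) (-4 * (k : ℂ) + 1)

/-- The error of `root7Approx` as an approximation of `ζ(4k-1)`. -/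
noncomputable def root7Error (k N : ℕ) : ℝ :=
  ‖riemannZeta (4 * (k : ℂ) - 1) - root7Approx k N‖

/-- The error of `classicalApprox` as an approximation of `ζ(4k-1)`. -/
noncomputable def classicalError (k N : ℕ) : ℝ :=
  ‖riemannZeta (4 * (k : ℂ) - 1) - classicalApprox k N‖

/-- The errors `e N` of successive truncations tend to zero, and the number of decimal digits
gained with one further term, `log₁₀ (e N / e (N + 1))`, tends to `d`. -/
def HasDigitRate (e : ℕ → ℝ) (d : ℝ) : Prop :=
  (∀ᶠ N in atTop, 0 < e N) ∧ Tendsto e atTop (𝓝 0) ∧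
    Tendsto (fun N => Real.logb 10 (e N / e (N + 1))) atTop (𝓝 d)

/-! Write `C(τ) = ∑ cot(πnτ)/n^(4k-1)`. In the upper half plane the `q`-expansion of the cotangent
gives `C(τ) = -i(ζ(4k-1) + 2L_q(1-4k))` with `q = e^(2πiτ)`, so linear relations among values of `C`
are relations between the zeta value and Lambert series. `C` is odd and 1-periodic. It also
satisfies an inversion formula relating `τ^(2-4k) C(τ)` and `C(1/τ)` up to an explicit Bernoulli sum
(`cotSum_inversion`), and a Hecke relation at 2 among `τ/2`, `(τ+1)/2`, `τ`, `2τ`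
(`cotSum_hecke_two`).

At `τ = i` inversion alone gives the classical formula. For the other one, let `α = (1+i√7)/2` and
let `β` be its conjugate, so `α+β = 1` and `αβ = 2`. Inversion at `α` and at `β` introduces `C(1/α)`
and `C(1/β)`. The Hecke relation at `-β` involves exactly these, because `-β/2 = -1/α` and `(1-β)/2
= 1/β`; its other points reduce modulo 1 to `α` and `i√7`. Eliminating leaves `C(α)` and `C(i√7)`
(`cotSum_cmPoint7`). A second Hecke relation, at `i√7`, trades `C(α)` for the values at `i√7/2`,
`i√7`, `2i√7` (`cotSum_cmPoint7_eq`), whose nomes are the three in the formula. The polar form of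
`α` turns its powers into the cosines in `a_k`, `b_k`, `c_{jk}`.

For the rates, a Lambert tail is asymptotic to a constant times `q^(N+1)/(N+1)^(4k-1)`
(`tendsto_realLambertTail_div`). The nome `e^(-√7π)` dominates, and its coefficient `b_k/a_k` is
positive. -/

/-! ### Cotangent identities; parity and periodicity of the cotangent sum. -/

/-- The cotangent Dirichlet series `∑_{n ≥ 1} cot (π n τ) / n ^ p`. -/
noncomputable def cotSum (p : ℕ) (τ : ℂ) : ℂ :=
  ∑' n : ℕ, Complex.cot (Real.pi * (((n : ℂ) + 1) * τ)) / ((n : ℂ) + 1) ^ p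

lemma Complex.cot_neg' (z : ℂ) : Complex.cot (-z) = -Complex.cot z := by
  simp [Complex.cot, div_neg]

lemma Complex.cot_add_pi (z : ℂ) : Complex.cot (z + Real.pi) = Complex.cot z := by
  simp [Complex.cot, Complex.cos_add_pi, Complex.sin_add_pi]

lemma Complex.cot_add_nat_mul_pi (z : ℂ) (n : ℕ) :
    Complex.cot (z + n * Real.pi) = Complex.cot z := by
  induction n with
  | zero => simp
  | succ n ih => rw [← ih, ← Complex.cot_add_pi (z + n * Real.pi)]; push_cast; ring_nf

lemma Complex.cot_add_cot_add_pi_div_two (z : ℂ) :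
    Complex.cot z + Complex.cot (z + Real.pi / 2) = 2 * Complex.cot (2 * z) := by
  simp only [Complex.cot, Complex.cos_add_pi_div_two, Complex.sin_add_pi_div_two,
    Complex.sin_two_mul, Complex.cos_two_mul']
  -- At the poles every quotient is zero by the convention for division by zero, so the identity
  -- needs no hypothesis on `z`.
  by_cases hs : Complex.sin z = 0
  · simp [hs]
  by_cases hc : Complex.cos z = 0
  · simp [hc]
  field_simp
  ring

lemma cotSum_neg (p : ℕ) (τ : ℂ) : cotSum p (-τ) = -cotSum p τ := by
  simp only [cotSum, mul_neg, Complex.cot_neg', neg_div, tsum_neg]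

lemma cotSum_add_one (p : ℕ) (τ : ℂ) : cotSum p (τ + 1) = cotSum p τ := by
  unfold cotSum
  refine tsum_congr fun n => ?_
  rw [show (Real.pi : ℂ) * (((n : ℂ) + 1) * (τ + 1))
      = Real.pi * (((n : ℂ) + 1) * τ) + (n + 1 : ℕ) * Real.pi by push_cast; ring,
    Complex.cot_add_nat_mul_pi]

/-! ### Absolute convergence of the partial-fraction double series. -/

lemma im_ne_zero_mul_nat {τ : ℂ} (hτ : τ.im ≠ 0) (n : ℕ) : (((n : ℂ) + 1) * τ).im ≠ 0 := by
  have : (((n : ℂ) + 1) * τ).im = ((n : ℝ) + 1) * τ.im := by simp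
  rw [this]
  positivity

lemma mem_integerComplement_of_im_ne_zero {z : ℂ} (hz : z.im ≠ 0) :
    z ∈ Complex.integerComplement := by
  rintro ⟨n, rfl⟩
  simp at hz

lemma one_div_im_ne_zero {τ : ℂ} (hτ : τ.im ≠ 0) : (1 / τ).im ≠ 0 := by
  have hτ0 : τ ≠ 0 := by rintro rfl; simp at hτ
  have : Complex.normSq τ ≠ 0 := by simpa using hτ0
  rw [one_div, Complex.inv_im]
  exact div_ne_zero (neg_ne_zero.2 hτ) this

/-- Both factors of `z² - w² = (z+w)(z-w)` have imaginary part `z.im`, since `w` is real. -/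
lemma sq_le_norm_sq_sub_sq (z w : ℂ) (hw : w.im = 0) : z.im ^ 2 ≤ ‖z ^ 2 - w ^ 2‖ := by
  rw [sq_sub_sq, norm_mul]
  have h1 := Complex.abs_im_le_norm (z + w)
  have h2 := Complex.abs_im_le_norm (z - w)
  simp only [Complex.add_im, Complex.sub_im, hw, add_zero, sub_zero] at h1 h2
  rw [← sq_abs, sq]
  gcongr

lemma sq_sub_sq_ne_zero {τ : ℂ} (hτ : τ.im ≠ 0) (n l : ℕ) :
    (((n : ℂ) + 1) * τ) ^ 2 - ((l : ℂ) + 1) ^ 2 ≠ 0 := by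
  have h := sq_le_norm_sq_sub_sq (((n : ℂ) + 1) * τ) ((l : ℂ) + 1) (by simp)
  have h2 := im_ne_zero_mul_nat hτ n
  rw [← norm_pos_iff]
  exact lt_of_lt_of_le (by positivity) h

/-- The terms of the double series behind `cotSum`. -/
noncomputable def cotKernel (m : ℕ) (τ : ℂ) (x : ℕ × ℕ) : ℂ :=
  1 / (((x.1 : ℂ) + 1) ^ (2 * m) * ((((x.1 : ℂ) + 1) * τ) ^ 2 - ((x.2 : ℂ) + 1) ^ 2))

lemma summable_one_div_succ_pow {s : ℕ} (hs : 1 < s) :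
    Summable fun n : ℕ => 1 / ((n : ℝ) + 1) ^ s := by
  have := (summable_nat_add_iff 1).2 (Real.summable_one_div_nat_pow.2 hs)
  simpa using this

lemma norm_natCast_add_one (n : ℕ) : ‖(n : ℂ) + 1‖ = (n : ℝ) + 1 := by
  have := Complex.norm_natCast (n + 1)
  push_cast at this
  exact this

/-- The factor `n^(2m)` already handles `n`, so decay in `l` is what is needed. Pulling out `τ²` and
bounding by the imaginary part of `l/τ` shows that the quadratic factor is at least `c l²`, and a
product of two convergent series dominates. -/
lemma summable_cotKernel {m : ℕ} (hm : 1 ≤ m) {τ : ℂ} (hτ : τ.im ≠ 0) :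
    Summable (cotKernel m τ) := by
  have hτ0 : τ ≠ 0 := by rintro rfl; simp at hτ
  have hi := one_div_im_ne_zero hτ
  set c : ℝ := ‖τ‖ ^ 2 * (1 / τ).im ^ 2 with hc
  have hcpos : 0 < c := by positivity
  have hsum := ((summable_one_div_succ_pow (s := 2 * m) (by omega)).mul_of_nonneg
    (summable_one_div_succ_pow (s := 2) (by omega)) (fun _ => by positivity)
    (fun _ => by positivity)).mul_left (1 / c)
  refine Summable.of_norm_bounded hsum ?_
  rintro ⟨n, l⟩
  have h : c * ((l : ℝ) + 1) ^ 2 ≤ ‖(((n : ℂ) + 1) * τ) ^ 2 - ((l : ℂ) + 1) ^ 2‖ := by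
    have h1 := sq_le_norm_sq_sub_sq (((l : ℂ) + 1) * (1 / τ)) ((n : ℂ) + 1) (by simp)
    have h2 : (((n : ℂ) + 1) * τ) ^ 2 - ((l : ℂ) + 1) ^ 2
        = -(τ ^ 2 * ((((l : ℂ) + 1) * (1 / τ)) ^ 2 - ((n : ℂ) + 1) ^ 2)) := by
      field_simp
      ring
    have h3 : (((l : ℂ) + 1) * (1 / τ)).im = ((l : ℝ) + 1) * (1 / τ).im := by
      generalize 1 / τ = w
      simp
    rw [h2, norm_neg, norm_mul, norm_pow]
    rw [h3] at h1
    calc c * ((l : ℝ) + 1) ^ 2 = ‖τ‖ ^ 2 * (((l : ℝ) + 1) * (1 / τ).im) ^ 2 := by rw [hc]; ring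
      _ ≤ _ := by gcongr
  simp only [cotKernel, norm_div, norm_mul, norm_one, norm_pow, norm_natCast_add_one]
  calc _ ≤ 1 / (((n : ℝ) + 1) ^ (2 * m) * (c * ((l : ℝ) + 1) ^ 2)) := by gcongr
    _ = _ := by field_simp

/-- Mittag-Leffler expansion of the cotangent, with the poles at `±l` paired. -/
lemma cot_term_eq {m : ℕ} {τ : ℂ} (hτ : τ.im ≠ 0) (n : ℕ) :
    Complex.cot (Real.pi * (((n : ℂ) + 1) * τ)) / ((n : ℂ) + 1) ^ (2 * m + 1)
      = 1 / (Real.pi * τ) * (1 / ((n : ℂ) + 1) ^ (2 * m + 2))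
        + 2 * τ / Real.pi * ∑' l : ℕ, cotKernel m τ (n, l) := by
  have hτ0 : τ ≠ 0 := by rintro rfl; simp at hτ
  have hn : (n : ℂ) + 1 ≠ 0 := by exact_mod_cast n.succ_ne_zero
  have hpi : (Real.pi : ℂ) ≠ 0 := by exact_mod_cast Real.pi_ne_zero
  have h := cot_series_rep' (mem_integerComplement_of_im_ne_zero (im_ne_zero_mul_nat hτ n))
  have h2 : ∀ l : ℕ, 1 / (((n : ℂ) + 1) * τ - (l + 1)) + 1 / (((n : ℂ) + 1) * τ + (l + 1))
      = 2 * τ * ((n : ℂ) + 1) ^ (2 * m + 1) * cotKernel m τ (n, l) := by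
    intro l
    have h3 := sq_sub_sq_ne_zero hτ n l
    have h4 := h3
    rw [sq_sub_sq] at h4
    have h5 := left_ne_zero_of_mul h4
    have h6 := right_ne_zero_of_mul h4
    simp only [cotKernel]
    rw [div_add_div _ _ h6 h5, ← mul_div_assoc, mul_one,
      div_eq_div_iff (mul_ne_zero h6 h5) (mul_ne_zero (pow_ne_zero _ hn) h3)]
    ring
  rw [tsum_congr h2, tsum_mul_left] at h
  have h7 : Complex.cot (Real.pi * (((n : ℂ) + 1) * τ)) = (1 / (((n : ℂ) + 1) * τ)
      + 2 * τ * ((n : ℂ) + 1) ^ (2 * m + 1) * ∑' l : ℕ, cotKernel m τ (n, l)) / Real.pi := by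
    rw [eq_div_iff hpi, ← h]
    ring
  rw [h7]
  field_simp
  ring

lemma summable_one_div_succ_pow_complex {s : ℕ} (hs : 1 < s) :
    Summable fun n : ℕ => 1 / ((n : ℂ) + 1) ^ s := by
  refine Summable.of_norm ?_
  simpa [norm_natCast_add_one] using summable_one_div_succ_pow hs

lemma tsum_one_div_succ_pow {s : ℕ} (hs : 1 < s) :
    ∑' n : ℕ, 1 / ((n : ℂ) + 1) ^ s = riemannZeta s := by
  rw [zeta_eq_tsum_one_div_nat_add_one_cpow (by simpa using hs)]
  simp

lemma hasSum_cotSum {m : ℕ} (hm : 1 ≤ m) {τ : ℂ} (hτ : τ.im ≠ 0) :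
    HasSum (fun n : ℕ => Complex.cot (Real.pi * (((n : ℂ) + 1) * τ)) / ((n : ℂ) + 1) ^ (2 * m + 1))
      (1 / (Real.pi * τ) * riemannZeta (2 * m + 2 : ℕ)
        + 2 * τ / Real.pi * ∑' x : ℕ × ℕ, cotKernel m τ x) := by
  simp_rw [cot_term_eq hτ]
  rw [← tsum_one_div_succ_pow (by omega)]
  refine ((summable_one_div_succ_pow_complex (by omega)).hasSum.mul_left _).add (.mul_left _ ?_)
  have h := summable_cotKernel hm hτ
  rw [h.tsum_prod]
  exact h.prod.hasSum

lemma summable_cotSum {m : ℕ} (hm : 1 ≤ m) {τ : ℂ} (hτ : τ.im ≠ 0) :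
    Summable (fun n : ℕ => Complex.cot (Real.pi * (((n : ℂ) + 1) * τ))
      / ((n : ℂ) + 1) ^ (2 * m + 1)) :=
  (hasSum_cotSum hm hτ).summable

/-! ### The Hecke relation at 2. -/

/-- The Hecke relation at the prime two. -/
lemma cotSum_hecke_two {m : ℕ} (hm : 1 ≤ m) {τ : ℂ} (hτ : τ.im ≠ 0) :
    cotSum (2 * m + 1) (τ / 2) + cotSum (2 * m + 1) ((τ + 1) / 2) - 2 * cotSum (2 * m + 1) τ
      = 2 / 2 ^ (2 * m + 1) * (cotSum (2 * m + 1) τ - cotSum (2 * m + 1) (2 * τ)) := by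
  have s1 := summable_cotSum hm (τ := τ / 2) (by simpa using hτ)
  have s2 := summable_cotSum hm (τ := (τ + 1) / 2) (by simpa using hτ)
  have s3 := summable_cotSum hm hτ
  have s4 := summable_cotSum hm (τ := 2 * τ) (by simpa using hτ)
  simp only [cotSum]
  rw [← s1.tsum_add s2, ← tsum_mul_left, ← (s1.add s2).tsum_sub (s3.mul_left 2),
    ← s3.tsum_sub s4, ← tsum_mul_left]
  -- The index is shifted by one: `2r+1` stands for the even integer `2(r+1)`. Only these
  -- contribute; for odd integers the duplication formula makes the summand on the left vanish.
  have hinj : Function.Injective fun r : ℕ => 2 * r + 1 := fun a b h => by simpa using h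
  rw [← hinj.tsum_eq]
  · refine tsum_congr fun r => ?_
    have e1 : (Real.pi : ℂ) * ((((2 * r + 1 : ℕ) : ℂ) + 1) * (τ / 2))
        = Real.pi * (((r : ℂ) + 1) * τ) := by push_cast; ring
    have e2 : (Real.pi : ℂ) * ((((2 * r + 1 : ℕ) : ℂ) + 1) * ((τ + 1) / 2))
        = Real.pi * (((r : ℂ) + 1) * τ) + (r + 1 : ℕ) * Real.pi := by push_cast; ring
    have e3 : (Real.pi : ℂ) * ((((2 * r + 1 : ℕ) : ℂ) + 1) * τ)
        = Real.pi * (((r : ℂ) + 1) * (2 * τ)) := by push_cast; ring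
    have e4 : ((2 * r + 1 : ℕ) : ℂ) + 1 = 2 * ((r : ℂ) + 1) := by push_cast; ring
    rw [e1, e2, e3, Complex.cot_add_nat_mul_pi, e4, mul_pow]
    have hn : (r : ℂ) + 1 ≠ 0 := by exact_mod_cast r.succ_ne_zero
    field_simp
    ring
  · intro n hn
    by_contra hcon
    have hev : Even n := by
      by_contra ho
      obtain ⟨r, hr⟩ := Nat.not_even_iff_odd.1 ho
      exact hcon ⟨r, hr.symm⟩
    obtain ⟨r, rfl⟩ := hev
    refine hn ?_
    have e2 : (Real.pi : ℂ) * ((((r + r : ℕ) : ℂ) + 1) * ((τ + 1) / 2))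
        = (Real.pi * ((((r + r : ℕ) : ℂ) + 1) * (τ / 2)) + Real.pi / 2) + r * Real.pi := by
      push_cast; ring
    have e3 : (Real.pi : ℂ) * ((((r + r : ℕ) : ℂ) + 1) * τ)
        = 2 * (Real.pi * ((((r + r : ℕ) : ℂ) + 1) * (τ / 2))) := by ring
    simp only []
    rw [e2, e3, Complex.cot_add_nat_mul_pi, ← add_div, Complex.cot_add_cot_add_pi_div_two]
    ring

/-! ### The inversion formula for `τ ↦ 1/τ`. -/

lemma one_div_sub_one_div_eq_geom_sum {u v : ℂ} (hu : u ≠ 0) (hv : v ≠ 0) (huv : u - v ≠ 0)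
    (m : ℕ) :
    1 / (u ^ m * (u - v)) - 1 / (v ^ m * (u - v))
      = -∑ i ∈ Finset.range m, u ^ i / u ^ m * (1 / v ^ (i + 1)) := by
  have h := geom_sum₂_mul u v m
  have h2 : ∑ i ∈ Finset.range m, u ^ i / u ^ m * (1 / v ^ (i + 1))
      = (∑ i ∈ Finset.range m, u ^ i * v ^ (m - 1 - i)) / (u ^ m * v ^ m) := by
    rw [Finset.sum_div]
    refine Finset.sum_congr rfl fun i hi => ?_
    have hi' := Finset.mem_range.1 hi
    have : v ^ m = v ^ (m - 1 - i) * v ^ (i + 1) := by rw [← pow_add]; congr 1; omega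
    rw [this]
    field_simp
  rw [h2, eq_div_of_mul_eq huv h]
  field_simp
  ring

/-- Take `u = (nτ)²` and `v = l²`. Swapping `n` and `l` while inverting `τ` exchanges `1/(u^m(u-v))`
with `-1/(v^m(u-v))`. Their sum has no factor `u-v` left in the denominator, so the variables
separate. -/
lemma cotKernel_add_cotKernel_swap (m : ℕ) {τ : ℂ} (hτ : τ.im ≠ 0) (n l : ℕ) :
    τ ^ (-2 * (m : ℤ)) * cotKernel m τ (n, l) + 1 / τ ^ 2 * cotKernel m (1 / τ) (l, n)
      = -∑ i ∈ Finset.range m, τ ^ (2 * (i : ℤ) - 2 * m) *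
          (1 / ((n : ℂ) + 1) ^ (2 * (m - i)) * (1 / ((l : ℂ) + 1) ^ (2 * (i + 1)))) := by
  have hτ0 : τ ≠ 0 := by rintro rfl; simp at hτ
  have hn : (n : ℂ) + 1 ≠ 0 := by exact_mod_cast n.succ_ne_zero
  have hl : (l : ℂ) + 1 ≠ 0 := by exact_mod_cast l.succ_ne_zero
  have huv := sq_sub_sq_ne_zero hτ n l
  have h := one_div_sub_one_div_eq_geom_sum (pow_ne_zero 2 (mul_ne_zero hn hτ0))
    (pow_ne_zero 2 hl) huv m
  have e1 : τ ^ (-2 * (m : ℤ)) * cotKernel m τ (n, l)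
      = 1 / (((((n : ℂ) + 1) * τ) ^ 2) ^ m * ((((n : ℂ) + 1) * τ) ^ 2 - ((l : ℂ) + 1) ^ 2)) := by
    have : τ ^ (-2 * (m : ℤ)) = 1 / τ ^ (2 * m) := by
      rw [neg_mul, zpow_neg, one_div]; norm_cast
    rw [this, cotKernel, ← pow_mul, mul_pow (_ + _) τ (2 * m), one_div_mul_one_div]
    congr 1
    ring
  have e2 : 1 / τ ^ 2 * cotKernel m (1 / τ) (l, n)
      = -(1 / ((((l : ℂ) + 1) ^ 2) ^ m * ((((n : ℂ) + 1) * τ) ^ 2 - ((l : ℂ) + 1) ^ 2))) := by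
    have : τ ^ 2 * ((((l : ℂ) + 1) * (1 / τ)) ^ 2 - ((n : ℂ) + 1) ^ 2)
        = -((((n : ℂ) + 1) * τ) ^ 2 - ((l : ℂ) + 1) ^ 2) := by
      field_simp
      ring
    rw [cotKernel, one_div_mul_one_div, ← pow_mul, mul_left_comm, this, mul_neg, one_div_neg_eq_neg_one_div]
  rw [e1, e2, ← sub_eq_add_neg, h]
  congr 1
  refine Finset.sum_congr rfl fun i hi => ?_
  have hi' := Finset.mem_range.1 hi
  obtain ⟨d, rfl⟩ : ∃ d, m = i + d := ⟨m - i, by omega⟩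
  have : τ ^ (2 * (i : ℤ) - 2 * ((i + d : ℕ) : ℤ)) = 1 / τ ^ (2 * d) := by
    rw [show 2 * (i : ℤ) - 2 * ((i + d : ℕ) : ℤ) = -((2 * d : ℕ) : ℤ) by push_cast; ring,
      zpow_neg, one_div, zpow_natCast]
  rw [this, Nat.add_sub_cancel_left, pow_mul _ 2 (i + 1), pow_add _ i d]
  generalize (n : ℂ) + 1 = N at *
  field_simp
  ring

/-- Absolute convergence allows the swap of `n` and `l`; each separated term then sums to a product
of two even zeta values. -/
lemma tsum_cotKernel_inversion {m : ℕ} (hm : 1 ≤ m) {τ : ℂ} (hτ : τ.im ≠ 0) :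
    τ ^ (-2 * (m : ℤ)) * ∑' x, cotKernel m τ x
      + 1 / τ ^ 2 * ∑' x, cotKernel m (1 / τ) x
      = -∑ i ∈ Finset.range m, τ ^ (2 * (i : ℤ) - 2 * m) *
          (riemannZeta (2 * (m - i) : ℕ) * riemannZeta (2 * (i + 1) : ℕ)) := by
  have hi := one_div_im_ne_zero hτ
  have s1 := summable_cotKernel hm hτ
  have s2 := summable_cotKernel hm hi
  have s2' : Summable fun x : ℕ × ℕ => cotKernel m (1 / τ) x.swap :=
    (Equiv.prodComm ℕ ℕ).summable_iff.2 s2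
  have t2 : ∑' x : ℕ × ℕ, cotKernel m (1 / τ) x.swap = ∑' x, cotKernel m (1 / τ) x :=
    (Equiv.prodComm ℕ ℕ).tsum_eq _
  rw [← t2, ← tsum_mul_left, ← tsum_mul_left, ← (s1.mul_left _).tsum_add (s2'.mul_left _)]
  have : ∀ x : ℕ × ℕ, τ ^ (-2 * (m : ℤ)) * cotKernel m τ x
      + 1 / τ ^ 2 * cotKernel m (1 / τ) x.swap
      = ∑ i ∈ Finset.range m, -(τ ^ (2 * (i : ℤ) - 2 * m) *
        (1 / ((x.1 : ℂ) + 1) ^ (2 * (m - i)) * (1 / ((x.2 : ℂ) + 1) ^ (2 * (i + 1))))) := by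
    rintro ⟨n, l⟩
    rw [Finset.sum_neg_distrib]
    exact cotKernel_add_cotKernel_swap m hτ n l
  rw [tsum_congr this, ← Finset.sum_neg_distrib]
  have hs : ∀ i ∈ Finset.range m, Summable fun x : ℕ × ℕ =>
      (1 / ((x.1 : ℂ) + 1) ^ (2 * (m - i)) * (1 / ((x.2 : ℂ) + 1) ^ (2 * (i + 1)))) := by
    intro i hi
    have := Finset.mem_range.1 hi
    exact summable_mul_of_summable_norm (f := fun n : ℕ => 1 / ((n : ℂ) + 1) ^ (2 * (m - i)))
      (g := fun l : ℕ => 1 / ((l : ℂ) + 1) ^ (2 * (i + 1)))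
      (summable_one_div_succ_pow_complex (s := 2 * (m - i)) (by omega)).norm
      (summable_one_div_succ_pow_complex (s := 2 * (i + 1)) (by omega)).norm
  rw [Summable.tsum_finsetSum fun i hi => ((hs i hi).mul_left _).neg]
  refine Finset.sum_congr rfl fun i hi => ?_
  have hi' := Finset.mem_range.1 hi
  rw [tsum_neg, tsum_mul_left, ← tsum_one_div_succ_pow (by omega),
    ← tsum_one_div_succ_pow (by omega), tsum_mul_tsum_of_summable_norm
      (summable_one_div_succ_pow_complex (s := 2 * (m - i)) (by omega)).norm
      (summable_one_div_succ_pow_complex (s := 2 * (i + 1)) (by omega)).norm]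

lemma cotSum_inversion_zeta {m : ℕ} (hm : 1 ≤ m) {τ : ℂ} (hτ : τ.im ≠ 0) :
    τ ^ (-2 * (m : ℤ)) * cotSum (2 * m + 1) τ + cotSum (2 * m + 1) (1 / τ)
      = -(2 / Real.pi) * ∑ j ∈ Finset.range (m + 2), τ ^ (1 - 2 * (j : ℤ)) *
          (riemannZeta (2 * j) * riemannZeta (2 * (m + 1 - j : ℕ))) := by
  have hτ0 : τ ≠ 0 := by rintro rfl; simp at hτ
  have hi := one_div_im_ne_zero hτ
  have hpi : (Real.pi : ℂ) ≠ 0 := by exact_mod_cast Real.pi_ne_zero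
  have key := tsum_cotKernel_inversion hm hτ
  have c1 : cotSum (2 * m + 1) τ = _ := (hasSum_cotSum hm hτ).tsum_eq
  have c2 : cotSum (2 * m + 1) (1 / τ) = _ := (hasSum_cotSum hm hi).tsum_eq
  have key2 : τ ^ (-2 * (m : ℤ)) * (2 * τ / Real.pi * ∑' x, cotKernel m τ x)
      + 2 * (1 / τ) / Real.pi * ∑' x, cotKernel m (1 / τ) x
      = 2 * τ / Real.pi * -∑ i ∈ Finset.range m, τ ^ (2 * (i : ℤ) - 2 * m) *
          (riemannZeta (2 * (m - i) : ℕ) * riemannZeta (2 * (i + 1) : ℕ)) := by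
    rw [← key, mul_add]
    field_simp
  rw [c1, c2, mul_add, add_add_add_comm, key2, Finset.sum_range_succ, Finset.sum_range_succ']
  rw [← Finset.sum_range_reflect]
  have e3 : ∀ j ∈ Finset.range m, τ ^ (2 * ((m - 1 - j : ℕ) : ℤ) - 2 * m) *
      (riemannZeta (2 * (m - (m - 1 - j)) : ℕ) * riemannZeta (2 * ((m - 1 - j) + 1) : ℕ))
      = τ⁻¹ * (τ ^ (1 - 2 * ((j + 1 : ℕ) : ℤ)) * (riemannZeta (2 * (j + 1 : ℕ))
        * riemannZeta (2 * (m + 1 - (j + 1) : ℕ)))) := by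
    intro j hj
    have hj' := Finset.mem_range.1 hj
    rw [← mul_assoc τ⁻¹, ← zpow_neg_one, ← zpow_add₀ hτ0]
    have a1 : m - (m - 1 - j) = j + 1 := by omega
    have a2 : m - 1 - j + 1 = m + 1 - (j + 1) := by omega
    have a3 : 2 * ((m - 1 - j : ℕ) : ℤ) - 2 * m = -1 + (1 - 2 * ((j + 1 : ℕ) : ℤ)) := by omega
    rw [a1, a2, a3]
    norm_cast
  rw [Finset.sum_congr rfl e3, ← Finset.mul_sum]
  have z1 : τ ^ (1 - 2 * ((m + 1 : ℕ) : ℤ)) = τ ^ (-2 * (m : ℤ)) * τ⁻¹ := by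
    rw [← zpow_neg_one, ← zpow_add₀ hτ0]
    congr 1
    push_cast
    ring
  rw [z1]
  have z2 : riemannZeta (2 * ((m + 1 : ℕ) : ℂ)) = riemannZeta (2 * m + 2 : ℕ) := by
    congr 1; push_cast; ring
  -- Since `ζ(0) = -1/2`, the terms from the pole at the origin of the cotangent become the two
  -- extreme terms of the sum.
  simp only [Nat.sub_self, Nat.sub_zero, Nat.cast_zero, mul_zero, riemannZeta_zero, sub_zero,
    zpow_one]
  rw [z2]
  field_simp
  ring

/-- Euler's evaluation of even zeta values makes the inversion formula explicit. -/
lemma cotSum_inversion {k : ℕ} (hk : 1 ≤ k) {τ : ℂ} (hτ : τ.im ≠ 0) :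
    τ ^ (2 - 4 * (k : ℤ)) * cotSum (4 * k - 1) τ + cotSum (4 * k - 1) (1 / τ)
      = -(2 * (Real.pi : ℂ)) ^ (4 * k - 1) * ∑ j ∈ Finset.range (2 * k + 1),
          τ ^ (1 - 2 * (j : ℤ)) * ((bernoulli (2 * j) : ℂ) * (bernoulli (4 * k - 2 * j) : ℂ)
            / (((2 * j).factorial : ℂ) * ((4 * k - 2 * j).factorial : ℂ))) := by
  have h := cotSum_inversion_zeta (m := 2 * k - 1) (by omega) hτ
  have hpi : (Real.pi : ℂ) ≠ 0 := by exact_mod_cast Real.pi_ne_zero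
  rw [show 2 * (2 * k - 1) + 1 = 4 * k - 1 by omega, show 2 * k - 1 + 2 = 2 * k + 1 by omega,
    show -2 * ((2 * k - 1 : ℕ) : ℤ) = 2 - 4 * (k : ℤ) by omega,
    show 2 * k - 1 + 1 = 2 * k by omega] at h
  rw [h, Finset.mul_sum, Finset.mul_sum]
  refine Finset.sum_congr rfl fun j hj => ?_
  have hj' := Finset.mem_range.1 hj
  obtain ⟨d, hd⟩ : ∃ d, 2 * k = j + d := ⟨2 * k - j, by omega⟩
  have h4 : 4 * k - 2 * j = 2 * d := by omega
  have h5 : 2 * k - j = d := by omega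
  obtain ⟨e, he⟩ : ∃ e, 4 * k - 1 = e ∧ e + 1 = 2 * j + 2 * d := ⟨4 * k - 1, by omega, by omega⟩
  have hpw : (2 * (Real.pi : ℂ)) ^ e = 2 ^ (2 * j + 2 * d) * Real.pi ^ (2 * j + 2 * d) / (2 * Real.pi) := by
    rw [← mul_pow, ← he.2, pow_succ]
    field_simp
  -- The signs in Euler's formula cancel because `j + d = 2k` is even.
  have hsgn : (-1 : ℂ) ^ (j + 1) * (-1) ^ (d + 1) = 1 := by
    rw [← pow_add]
    exact Even.neg_one_pow ⟨k + 1, by omega⟩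
  have hz : ∀ i : ℕ, (2 : ℂ) ^ (2 * (i : ℤ) - 1) = 2 ^ (2 * i) / 2 := by
    intro i
    rw [zpow_sub_one₀ two_ne_zero]
    norm_cast
  rw [h4, h5, riemannZeta_two_mul_nat', riemannZeta_two_mul_nat', hz, hz, he.1, neg_mul, neg_mul,
    hpw]
  have f1 : ((2 * j).factorial : ℂ) ≠ 0 := by exact_mod_cast Nat.factorial_ne_zero _
  have f2 : ((2 * d).factorial : ℂ) ≠ 0 := by exact_mod_cast Nat.factorial_ne_zero _
  rw [neg_inj]
  generalize τ ^ (1 - 2 * (j : ℤ)) = T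
  generalize (bernoulli (2 * j) : ℂ) = B1
  generalize (bernoulli (2 * d) : ℂ) = B2
  generalize ((2 * j).factorial : ℂ) = F1 at *
  generalize ((2 * d).factorial : ℂ) = F2 at *
  calc _ = ((-1 : ℂ) ^ (j + 1) * (-1) ^ (d + 1)) * (2 / Real.pi * (T * (2 ^ (2 * j) / 2
        * Real.pi ^ (2 * j) * B1 / F1 * (2 ^ (2 * d) / 2 * Real.pi ^ (2 * d) * B2 / F2)))) := by
        ring
    _ = _ := by
        rw [hsgn]
        field_simp
        ring

/-! ### Cotangent sums as Lambert series. -/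

lemma natCast_succ_cpow_neg {k : ℕ} (hk : 1 ≤ k) (n : ℕ) :
    ((n + 1 : ℕ) : ℂ) ^ (-4 * (k : ℂ) + 1) = 1 / ((n : ℂ) + 1) ^ (4 * k - 1) := by
  have : -4 * (k : ℂ) + 1 = -((4 * k - 1 : ℕ) : ℂ) := by
    rw [Nat.cast_sub (by omega)]; push_cast; ring
  rw [this, Complex.cpow_neg, Complex.cpow_natCast, one_div]
  push_cast
  rfl

lemma lambertTerm_eq {k : ℕ} (hk : 1 ≤ k) (q : ℂ) (n : ℕ) :
    lambertTerm q (-4 * (k : ℂ) + 1) (n + 1)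
      = 1 / ((n : ℂ) + 1) ^ (4 * k - 1) * (q ^ (n + 1) / (1 - q ^ (n + 1))) := by
  rw [lambertTerm, natCast_succ_cpow_neg hk, mul_div_assoc]

lemma norm_exp_two_pi_I_mul_lt_one {τ : ℂ} (hτ : 0 < τ.im) :
    ‖Complex.exp (2 * Real.pi * Complex.I * τ)‖ < 1 := by
  rw [Complex.norm_exp, Real.exp_lt_one_iff]
  have : (2 * Real.pi * Complex.I * τ).re = -(2 * Real.pi * τ.im) := by
    simp
  rw [this]
  have := Real.pi_pos
  nlinarith [mul_pos this hτ]

lemma one_sub_pow_succ_ne_zero {q : ℂ} (hq : ‖q‖ < 1) (n : ℕ) : 1 - q ^ (n + 1) ≠ 0 := by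
  intro h
  have h1 : ‖q ^ (n + 1)‖ < 1 := by
    rw [norm_pow]
    exact pow_lt_one₀ (norm_nonneg _) hq n.succ_ne_zero
  rw [← sub_eq_zero.1 h] at h1
  simp at h1

/-- With `Q = q^n`, `cot = -i(1 + 2Q/(1-Q))`: the constant feeds the zeta value and the rest the
Lambert series. -/
lemma cot_div_pow_eq_lambertTerm {k : ℕ} (hk : 1 ≤ k) {τ : ℂ} (hτ : 0 < τ.im) (n : ℕ) :
    Complex.cot (Real.pi * (((n : ℂ) + 1) * τ)) / ((n : ℂ) + 1) ^ (4 * k - 1)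
      = -Complex.I * (1 / ((n : ℂ) + 1) ^ (4 * k - 1)
        + 2 * lambertTerm (Complex.exp (2 * Real.pi * Complex.I * τ)) (-4 * (k : ℂ) + 1) (n + 1)) := by
  have hq := one_sub_pow_succ_ne_zero (norm_exp_two_pi_I_mul_lt_one hτ) n
  have hexp : Complex.exp (2 * Real.pi * Complex.I * (((n : ℂ) + 1) * τ))
      = Complex.exp (2 * Real.pi * Complex.I * τ) ^ (n + 1) := by
    rw [← Complex.exp_nat_mul]
    push_cast
    ring_nf
  rw [Complex.cot_pi_eq_exp_ratio, hexp, lambertTerm_eq hk]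
  generalize Complex.exp (2 * Real.pi * Complex.I * τ) ^ (n + 1) = Q at *
  have hI := Complex.I_ne_zero
  have hn : (n : ℂ) + 1 ≠ 0 := by exact_mod_cast n.succ_ne_zero
  field_simp
  rw [Complex.I_sq]
  ring

/-- Convergence is inherited from the cotangent sum and the zeta series, of which the Lambert term
is a linear combination. -/
lemma summable_lambertTerm {k : ℕ} (hk : 1 ≤ k) {τ : ℂ} (hτ : 0 < τ.im) :
    Summable fun n : ℕ =>
      lambertTerm (Complex.exp (2 * Real.pi * Complex.I * τ)) (-4 * (k : ℂ) + 1) (n + 1) := by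
  have h1 := summable_cotSum (m := 2 * k - 1) (by omega) hτ.ne'
  rw [show 2 * (2 * k - 1) + 1 = 4 * k - 1 by omega] at h1
  have h2 := summable_one_div_succ_pow_complex (s := 4 * k - 1) (by omega)
  refine (((h1.mul_left Complex.I).sub h2).mul_left (1 / 2)).congr fun n => ?_
  rw [cot_div_pow_eq_lambertTerm hk hτ, ← mul_assoc, mul_neg, Complex.I_mul_I]
  ring

lemma cotSum_eq_lambertSeries {k : ℕ} (hk : 1 ≤ k) {τ : ℂ} (hτ : 0 < τ.im) :
    cotSum (4 * k - 1) τ = -Complex.I * (riemannZeta (4 * (k : ℂ) - 1)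
      + 2 * lambertSeries (Complex.exp (2 * Real.pi * Complex.I * τ)) (-4 * (k : ℂ) + 1)) := by
  have h2 := summable_one_div_succ_pow_complex (s := 4 * k - 1) (by omega)
  have hz : riemannZeta (4 * (k : ℂ) - 1) = ∑' n : ℕ, 1 / ((n : ℂ) + 1) ^ (4 * k - 1) := by
    rw [tsum_one_div_succ_pow (by omega), Nat.cast_sub (by omega)]
    push_cast
    rfl
  rw [cotSum, tsum_congr (cot_div_pow_eq_lambertTerm hk hτ), tsum_mul_left, hz, lambertSeries,
    h2.tsum_add ((summable_lambertTerm hk hτ).mul_left 2), tsum_mul_left]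

lemma exp_two_pi_I_mul_eq_nome7 (m : ℕ) :
    Complex.exp (2 * Real.pi * Complex.I * (m * Complex.I * (Real.sqrt 7 : ℝ) / 2)) = nome7 m := by
  rw [nome7, Complex.ofReal_exp]
  congr 1
  push_cast
  linear_combination (m : ℂ) * Real.pi * (Real.sqrt 7 : ℝ) * Complex.I_sq

lemma exp_two_pi_I_mul_I :
    Complex.exp (2 * Real.pi * Complex.I * Complex.I) = ((Real.exp (-(2 * Real.pi)) : ℝ) : ℂ) := by
  rw [Complex.ofReal_exp]
  congr 1
  push_cast
  linear_combination 2 * (Real.pi : ℂ) * Complex.I_sq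

lemma im_natCast_mul_sqrt_seven_pos {m : ℕ} (hm : 0 < m) :
    0 < ((m : ℂ) * Complex.I * (Real.sqrt 7 : ℝ) / 2).im := by
  have : ((m : ℂ) * Complex.I * (Real.sqrt 7 : ℝ) / 2).im = m * Real.sqrt 7 / 2 := by
    simp
  rw [this]
  positivity

lemma summable_lambertTerm_nome7 {k : ℕ} (hk : 1 ≤ k) {m : ℕ} (hm : 0 < m) :
    Summable fun n : ℕ => lambertTerm (nome7 m) (-4 * (k : ℂ) + 1) (n + 1) := by
  have := summable_lambertTerm hk (im_natCast_mul_sqrt_seven_pos hm)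
  rwa [exp_two_pi_I_mul_eq_nome7] at this

lemma cotSum_eq_lambertSeries_nome7 {k : ℕ} (hk : 1 ≤ k) {m : ℕ} (hm : 0 < m) :
    cotSum (4 * k - 1) (m * Complex.I * (Real.sqrt 7 : ℝ) / 2) =
      -Complex.I * (riemannZeta (4 * (k : ℂ) - 1)
        + 2 * lambertSeries (nome7 m) (-4 * (k : ℂ) + 1)) := by
  rw [cotSum_eq_lambertSeries hk (im_natCast_mul_sqrt_seven_pos hm), exp_two_pi_I_mul_eq_nome7]

/-! ### Folding the Bernoulli sum; the classical formula. -/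

lemma neg_one_pow_two_mul_sub (R : Type*) [CommRing R] {j k : ℕ} (hj : j ≤ 2 * k) :
    (-1 : R) ^ (2 * k - j) = (-1) ^ j :=
  neg_one_pow_congr (by simp [Nat.even_sub hj])

/-- Pairs `j` with `2k-j`. The middle term is paired with itself, which is where the factor `1 +
δ_{jk}` comes from. -/
lemma sum_range_fold (k : ℕ) (f : ℕ → ℂ) :
    ∑ j ∈ Finset.range (2 * k + 1), f j
      = ∑ j ∈ Finset.range (k + 1), (f j + f (2 * k - j)) / (1 + if j = k then 1 else 0) := by
  rw [Finset.sum_range_succ _ k, show 2 * k + 1 = k + (k + 1) by ring, Finset.sum_range_add,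
    Finset.sum_range_succ' (fun x => f (k + x)), ← Finset.sum_range_reflect (fun x => f (k + (x + 1)))]
  have h : ∀ j ∈ Finset.range k, (f j + f (2 * k - j)) / (1 + if j = k then 1 else 0)
      = f j + f (k + (k - 1 - j + 1)) := by
    intro j hj
    have := Finset.mem_range.1 hj
    rw [if_neg this.ne, add_zero, div_one]
    congr 2
    omega
  rw [Finset.sum_congr rfl h, Finset.sum_add_distrib, if_pos rfl,
    show 2 * k - k = k by omega, add_zero]
  ring

/-- The classical formula, from the fixed point `τ = i`. -/
lemma zeta_classical {k : ℕ} (hk : 1 ≤ k) :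
    riemannZeta (4 * (k : ℂ) - 1) = (2 * (Real.pi : ℂ)) ^ (4 * k - 1) *
      ∑ j ∈ Finset.range (k + 1),
        (-1) ^ (j + 1) * (bernoulli (2 * j) : ℂ) * (bernoulli (4 * k - 2 * j) : ℂ)
          / (((2 * j).factorial : ℂ) * ((4 * k - 2 * j).factorial : ℂ)
              * (1 + if j = k then 1 else 0))
    - 2 * lambertSeries ((Real.exp (-(2 * Real.pi)) : ℝ) : ℂ) (-4 * (k : ℂ) + 1) := by
  have hinv := cotSum_inversion hk (τ := Complex.I) (by simp)
  have hC := cotSum_eq_lambertSeries hk (τ := Complex.I) (by simp)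
  rw [exp_two_pi_I_mul_I] at hC
  -- Inversion sends `i` to `-i`, so oddness leaves an equation for the single value at `i`.
  have e0 : 1 / Complex.I = -Complex.I := by simp
  have hz : ∀ j : ℕ, Complex.I ^ (1 - 2 * (j : ℤ)) = (-1) ^ j * Complex.I := by
    intro j
    rw [zpow_sub₀ Complex.I_ne_zero, zpow_one, zpow_mul, zpow_natCast]
    have : Complex.I ^ (2 : ℤ) = -1 := by rw [← Complex.I_sq]; norm_cast
    rw [this, div_eq_mul_inv, ← inv_pow, mul_comm]
    norm_num
  have e1 : Complex.I ^ (2 - 4 * (k : ℤ)) = -1 := by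
    have h := hz (2 * k - 1)
    have h2 : Complex.I ^ (2 - 4 * (k : ℤ)) = Complex.I ^ (1 - 2 * ((2 * k - 1 : ℕ) : ℤ)) / Complex.I := by
      rw [div_eq_mul_inv, ← zpow_sub_one₀ Complex.I_ne_zero]
      congr 1
      omega
    rw [h2, h, mul_div_cancel_right₀ _ Complex.I_ne_zero]
    exact Odd.neg_one_pow ⟨k - 1, by omega⟩
  rw [e0, e1, cotSum_neg, hC, sum_range_fold] at hinv
  have hs : ∑ j ∈ Finset.range (k + 1), (Complex.I ^ (1 - 2 * (j : ℤ)) *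
        ((bernoulli (2 * j) : ℂ) * (bernoulli (4 * k - 2 * j) : ℂ)
          / (((2 * j).factorial : ℂ) * ((4 * k - 2 * j).factorial : ℂ)))
      + Complex.I ^ (1 - 2 * ((2 * k - j : ℕ) : ℤ)) *
        ((bernoulli (2 * (2 * k - j)) : ℂ) * (bernoulli (4 * k - 2 * (2 * k - j)) : ℂ)
          / (((2 * (2 * k - j)).factorial : ℂ) * ((4 * k - 2 * (2 * k - j)).factorial : ℂ))))
            / (1 + if j = k then 1 else 0)
      = -(2 * Complex.I) * ∑ j ∈ Finset.range (k + 1),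
        (-1) ^ (j + 1) * (bernoulli (2 * j) : ℂ) * (bernoulli (4 * k - 2 * j) : ℂ)
          / (((2 * j).factorial : ℂ) * ((4 * k - 2 * j).factorial : ℂ)
              * (1 + if j = k then 1 else 0)) := by
    rw [Finset.mul_sum]
    refine Finset.sum_congr rfl fun j hj => ?_
    have hj' := Finset.mem_range.1 hj
    have hsgn := neg_one_pow_two_mul_sub ℂ (show j ≤ 2 * k by omega)
    rw [hz, hz, hsgn, show 2 * (2 * k - j) = 4 * k - 2 * j by omega,
      show 4 * k - (4 * k - 2 * j) = 2 * j by omega]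
    have : (1 + if j = k then 1 else 0 : ℂ) ≠ 0 := by split_ifs <;> norm_num
    have f1 : ((2 * j).factorial : ℂ) ≠ 0 := by exact_mod_cast Nat.factorial_ne_zero _
    have f2 : ((4 * k - 2 * j).factorial : ℂ) ≠ 0 := by exact_mod_cast Nat.factorial_ne_zero _
    field_simp
    ring
  rw [hs] at hinv
  have hI := Complex.I_ne_zero
  rw [← mul_right_inj' (mul_ne_zero two_ne_zero hI)]
  linear_combination hinv

/-! ### The CM point of discriminant -7 and its trigonometric form. -/

/-- The CM point `(1 + i√7)/2`. -/
noncomputable def cmPoint7 : ℂ := (1 + Complex.I * (Real.sqrt 7 : ℝ)) / 2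

/-- Its complex conjugate. -/
noncomputable def cmPoint7Conj : ℂ := (1 - Complex.I * (Real.sqrt 7 : ℝ)) / 2

lemma sqrt_seven_sq_complex : ((Real.sqrt 7 : ℝ) : ℂ) ^ 2 = 7 := by
  have : Real.sqrt 7 ^ 2 = 7 := Real.sq_sqrt (by norm_num)
  exact_mod_cast this

lemma cmPoint7_im : cmPoint7.im = Real.sqrt 7 / 2 := by
  simp [cmPoint7]

lemma cmPoint7Conj_im : cmPoint7Conj.im = -Real.sqrt 7 / 2 := by
  simp [cmPoint7Conj]

lemma cmPoint7_mul_conj : cmPoint7 * cmPoint7Conj = 2 := by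
  rw [cmPoint7, cmPoint7Conj]
  linear_combination (-1 / 4 : ℂ) * (Complex.I ^ 2) * sqrt_seven_sq_complex - 7 / 4 * Complex.I_sq

lemma cmPoint7_ne_zero : cmPoint7 ≠ 0 := fun h => by simpa [h] using cmPoint7_mul_conj

lemma cmPoint7Conj_ne_zero : cmPoint7Conj ≠ 0 := fun h => by simpa [h] using cmPoint7_mul_conj

lemma cos_theta7 : Real.cos theta7 = Real.sqrt 7 / (2 * Real.sqrt 2) := by
  have h8 : Real.sqrt (1 + Real.sqrt 7 ^ 2) = 2 * Real.sqrt 2 := by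
    rw [Real.sq_sqrt (by norm_num), show (1 + 7 : ℝ) = 2 ^ 2 * 2 by norm_num,
      Real.sqrt_mul (by norm_num), Real.sqrt_sq (by norm_num)]
  rw [theta7, arccot, Real.cos_pi_div_two_sub, Real.sin_arctan, h8]

lemma sin_theta7 : Real.sin theta7 = 1 / (2 * Real.sqrt 2) := by
  have h8 : Real.sqrt (1 + Real.sqrt 7 ^ 2) = 2 * Real.sqrt 2 := by
    rw [Real.sq_sqrt (by norm_num), show (1 + 7 : ℝ) = 2 ^ 2 * 2 by norm_num,
      Real.sqrt_mul (by norm_num), Real.sqrt_sq (by norm_num)]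
  rw [theta7, arccot, Real.sin_pi_div_two_sub, Real.cos_arctan, h8]

lemma exp_pi_div_two_sub_mul_I (x : ℝ) :
    Complex.exp (((Real.pi / 2 - x : ℝ) : ℂ) * Complex.I)
      = (Real.sin x : ℝ) + (Real.cos x : ℝ) * Complex.I := by
  rw [Complex.exp_mul_I, ← Complex.ofReal_cos, ← Complex.ofReal_sin, Real.cos_pi_div_two_sub,
    Real.sin_pi_div_two_sub]

lemma sqrt_two_ne_zero_complex : ((Real.sqrt 2 : ℝ) : ℂ) ≠ 0 := by
  have : Real.sqrt 2 ≠ 0 := by positivity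
  exact_mod_cast this

/-- The modulus is `√2` because `αβ = 2`; the argument `arctan √7` is the complement of `θ`. -/
lemma cmPoint7_polar :
    cmPoint7 = (Real.sqrt 2 : ℝ) * Complex.exp (((Real.pi / 2 - theta7 : ℝ) : ℂ) * Complex.I) := by
  rw [exp_pi_div_two_sub_mul_I, sin_theta7, cos_theta7, cmPoint7]
  have := sqrt_two_ne_zero_complex
  push_cast
  field_simp

lemma cmPoint7Conj_polar :
    cmPoint7Conj
      = (Real.sqrt 2 : ℝ) * Complex.exp (((-(Real.pi / 2 - theta7) : ℝ) : ℂ) * Complex.I) := by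
  rw [Complex.exp_mul_I, ← Complex.ofReal_cos, ← Complex.ofReal_sin, Real.cos_neg, Real.sin_neg,
    Real.cos_pi_div_two_sub, Real.sin_pi_div_two_sub, sin_theta7, cos_theta7, cmPoint7Conj]
  have := sqrt_two_ne_zero_complex
  push_cast
  field_simp
  ring

lemma polar_zpow (r x : ℝ) (n : ℤ) :
    ((r : ℂ) * Complex.exp ((x : ℂ) * Complex.I)) ^ n
      = ((r ^ n * Real.cos (n * x) : ℝ) : ℂ) + ((r ^ n * Real.sin (n * x) : ℝ) : ℂ) * Complex.I := by
  rw [mul_zpow, ← Complex.exp_int_mul, ← mul_assoc, Complex.exp_mul_I]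
  push_cast
  ring

lemma cmPoint7_zpow_add (n : ℤ) :
    cmPoint7 ^ n + cmPoint7Conj ^ n
      = ((2 * Real.sqrt 2 ^ n * Real.cos (n * (Real.pi / 2 - theta7)) : ℝ) : ℂ) := by
  rw [cmPoint7_polar, cmPoint7Conj_polar, polar_zpow, polar_zpow, mul_neg, Real.cos_neg,
    Real.sin_neg]
  push_cast
  ring

lemma cmPoint7_zpow_sub (n : ℤ) :
    cmPoint7 ^ n - cmPoint7Conj ^ n
      = ((2 * Real.sqrt 2 ^ n * Real.sin (n * (Real.pi / 2 - theta7)) : ℝ) : ℂ) * Complex.I := by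
  rw [cmPoint7_polar, cmPoint7Conj_polar, polar_zpow, polar_zpow, mul_neg, Real.cos_neg,
    Real.sin_neg]
  push_cast
  ring

lemma sin_odd_mul_pi_div_two_sub (j : ℕ) (x : ℝ) :
    Real.sin (((1 - 2 * (j : ℤ) : ℤ) : ℝ) * (Real.pi / 2 - x))
      = (-1) ^ j * Real.cos ((2 * (j : ℝ) - 1) * x) := by
  have : (((1 - 2 * (j : ℤ) : ℤ) : ℝ) * (Real.pi / 2 - x))
      = Real.pi / 2 - (-((2 * (j : ℝ) - 1) * x) + j * Real.pi) := by push_cast; ring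
  rw [this, Real.sin_pi_div_two_sub, Real.cos_add_nat_mul_pi, Real.cos_neg]

lemma cos_mul_pi_div_two_sub {k : ℕ} (x : ℝ) :
    Real.cos (((2 - 4 * (k : ℤ) : ℤ) : ℝ) * (Real.pi / 2 - x))
      = -Real.cos ((4 * (k : ℝ) - 2) * x) := by
  have : (((2 - 4 * (k : ℤ) : ℤ) : ℝ) * (Real.pi / 2 - x))
      = ((4 * (k : ℝ) - 2) * x + Real.pi) - k * (2 * Real.pi) := by push_cast; ring
  rw [this, Real.cos_sub_nat_mul_two_pi, Real.cos_add_pi]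

lemma sqrt_two_zpow_two_mul (n : ℤ) : Real.sqrt 2 ^ (2 * n) = 2 ^ n := by
  rw [zpow_mul]
  congr 1
  have : Real.sqrt 2 ^ 2 = 2 := Real.sq_sqrt (by norm_num)
  exact_mod_cast this

lemma two_rpow_eq_sqrt_two_zpow (n : ℤ) : (2 : ℝ) ^ ((n : ℝ) / 2) = Real.sqrt 2 ^ n := by
  rw [Real.sqrt_eq_rpow, ← Real.rpow_intCast, ← Real.rpow_mul (by norm_num)]
  congr 1
  ring

lemma coeffA_pos {k : ℕ} (hk : 1 ≤ k) : 0 < coeffA k := by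
  have h1 := Real.neg_one_le_cos ((4 * (k : ℝ) - 2) * theta7)
  have h2 : (2 : ℝ) ^ 2 ≤ 2 ^ (2 * k) := pow_le_pow_right₀ (by norm_num) (by omega)
  rw [coeffA]
  linarith

/-- The trigonometric part of `b_k` is `4 cos ((4k - 2) θ)`. -/
lemma coeffB_eq (k : ℕ) :
    coeffB k = 2 ^ (2 * k + 1) + (2 : ℝ) ^ (-2 * (k : ℤ) + 2)
      + 4 * Real.cos ((4 * (k : ℝ) - 2) * theta7) := by
  have h32 : (2 : ℝ) ^ (3 / 2 : ℝ) = 2 * Real.sqrt 2 := by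
    have := two_rpow_eq_sqrt_two_zpow 3
    push_cast at this
    rw [this]
    have h2 : Real.sqrt 2 ^ 2 = 2 := Real.sq_sqrt (by norm_num)
    rw [show (3 : ℤ) = ((3 : ℕ) : ℤ) by rfl, zpow_natCast, pow_succ, h2]
  have h2 : Real.sqrt 2 ≠ 0 := by positivity
  have hs2 : Real.sqrt 2 ^ 2 = 2 := Real.sq_sqrt (by norm_num)
  have hs7 : Real.sqrt 7 ^ 2 = 7 := Real.sq_sqrt (by norm_num)
  have hc2 : Real.cos (2 * theta7) = 3 / 4 := by
    rw [Real.cos_two_mul, cos_theta7, div_pow, mul_pow, hs2, hs7]; norm_num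
  have hsn2 : Real.sin (2 * theta7) = Real.sqrt 7 / 4 := by
    rw [Real.sin_two_mul, cos_theta7, sin_theta7]
    field_simp
    -- Only `√2² = 2` remains after clearing the denominators.
    linear_combination (-2) * hs2
  rw [coeffB, h32, show (4 * (k : ℝ) + 1) * theta7 = 4 * (k : ℝ) * theta7 + theta7 by ring,
    show (4 * (k : ℝ) - 2) * theta7 = 4 * (k : ℝ) * theta7 - 2 * theta7 by ring, Real.sin_add,
    Real.cos_sub, hc2, hsn2, cos_theta7, sin_theta7]
  field_simp
  ring

lemma coeffB_pos {k : ℕ} (hk : 1 ≤ k) : 0 < coeffB k := by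
  have h1 := Real.neg_one_le_cos ((4 * (k : ℝ) - 2) * theta7)
  have h2 : (2 : ℝ) ^ 3 ≤ 2 ^ (2 * k + 1) := pow_le_pow_right₀ (by norm_num) (by omega)
  have h3 : 0 < (2 : ℝ) ^ (-2 * (k : ℤ) + 2) := by positivity
  rw [coeffB_eq]
  linarith

/-- The relation among cotangent sums coming from inversion and the Hecke operator at two. -/
lemma cotSum_cmPoint7 {k : ℕ} (hk : 1 ≤ k) :
    (cmPoint7 ^ (2 - 4 * (k : ℤ)) + cmPoint7Conj ^ (2 - 4 * (k : ℤ)) - 2 - 2 / 2 ^ (4 * k - 1))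
        * cotSum (4 * k - 1) cmPoint7
      + 2 / 2 ^ (4 * k - 1) * cotSum (4 * k - 1) (Complex.I * (Real.sqrt 7 : ℝ))
      = -(2 * (Real.pi : ℂ)) ^ (4 * k - 1) * ∑ j ∈ Finset.range (2 * k + 1),
          (cmPoint7 ^ (1 - 2 * (j : ℤ)) - cmPoint7Conj ^ (1 - 2 * (j : ℤ))) *
            ((bernoulli (2 * j) : ℂ) * (bernoulli (4 * k - 2 * j) : ℂ)
            / (((2 * j).factorial : ℂ) * ((4 * k - 2 * j).factorial : ℂ))) := by
  have h7 : Real.sqrt 7 ≠ 0 := by positivity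
  have h1 := cotSum_inversion hk (τ := cmPoint7) (by rw [cmPoint7_im]; positivity)
  have h2 := cotSum_inversion hk (τ := cmPoint7Conj)
    (by rw [cmPoint7Conj_im]; exact div_ne_zero (neg_ne_zero.2 h7) two_ne_zero)
  -- The point `-β` lies in the upper half plane, and the four arguments of its Hecke relation are
  -- `-1/α`, `1/β`, and, modulo 1, `α` and `i√7`.
  have h3 := cotSum_hecke_two (m := 2 * k - 1) (by omega) (τ := -cmPoint7Conj)
    (by rw [Complex.neg_im, cmPoint7Conj_im]; simp)
  rw [show 2 * (2 * k - 1) + 1 = 4 * k - 1 by omega] at h3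
  have e1 : -cmPoint7Conj / 2 = -(1 / cmPoint7) := by
    have := cmPoint7_ne_zero
    field_simp
    linear_combination -cmPoint7_mul_conj
  have e2 : (-cmPoint7Conj + 1) / 2 = 1 / cmPoint7Conj := by
    have := cmPoint7Conj_ne_zero
    have hs : -cmPoint7Conj + 1 = cmPoint7 := by rw [cmPoint7, cmPoint7Conj]; ring
    rw [hs]
    field_simp
    linear_combination cmPoint7_mul_conj
  have e3 : cotSum (4 * k - 1) (-cmPoint7Conj) = cotSum (4 * k - 1) cmPoint7 := by
    rw [← cotSum_add_one]
    congr 1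
    rw [cmPoint7, cmPoint7Conj]; ring
  have e4 : cotSum (4 * k - 1) (2 * -cmPoint7Conj)
      = cotSum (4 * k - 1) (Complex.I * (Real.sqrt 7 : ℝ)) := by
    rw [← cotSum_add_one]
    congr 1
    rw [cmPoint7Conj]; ring
  have e5 : cotSum (4 * k - 1) cmPoint7Conj = -cotSum (4 * k - 1) cmPoint7 := by
    rw [← e3, cotSum_neg, neg_neg]
  rw [e1, e2, e3, e4, cotSum_neg] at h3
  rw [e5] at h2
  simp_rw [sub_mul _ _ ((_ : ℂ) * _ / _)]
  rw [Finset.sum_sub_distrib]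
  linear_combination h1 - h2 + h3

/-- The Hecke relation at `i√7`, where `(τ+1)/2` is the CM point itself, solved for that value. -/
lemma cotSum_cmPoint7_eq {k : ℕ} (hk : 1 ≤ k) :
    cotSum (4 * k - 1) cmPoint7 = (2 + 2 / 2 ^ (4 * k - 1)) *
        cotSum (4 * k - 1) (Complex.I * (Real.sqrt 7 : ℝ))
      - 2 / 2 ^ (4 * k - 1) * cotSum (4 * k - 1) (2 * (Complex.I * (Real.sqrt 7 : ℝ)))
      - cotSum (4 * k - 1) (Complex.I * (Real.sqrt 7 : ℝ) / 2) := by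
  have h3 := cotSum_hecke_two (m := 2 * k - 1) (by omega) (τ := Complex.I * (Real.sqrt 7 : ℝ))
    (by simp)
  rw [show 2 * (2 * k - 1) + 1 = 4 * k - 1 by omega] at h3
  have : (Complex.I * (Real.sqrt 7 : ℝ) + 1) / 2 = cmPoint7 := by rw [cmPoint7]; ring
  rw [this] at h3
  linear_combination h3

/-- Identifies the folded imaginary parts of `α^(1-2j)` with `c_{jk}`; the denominator `a_k` and a
power of 2 are cleared. -/
lemma coeffC_eq {j k : ℕ} (hk : 1 ≤ k) (hj : j ≤ k) :
    (Real.sqrt 2 ^ (1 - 2 * (j : ℤ)) * ((-1) ^ j * Real.cos ((2 * (j : ℝ) - 1) * theta7))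
      + Real.sqrt 2 ^ (1 - 2 * ((2 * k - j : ℕ) : ℤ)) *
        ((-1) ^ (2 * k - j) * Real.cos ((2 * ((2 * k - j : ℕ) : ℝ) - 1) * theta7)))
      / (1 + if j = k then 1 else 0)
      = -(coeffA k / 2 ^ (2 * k) * ((-1) ^ (j + 1) * coeffC j k)) := by
  have hA := (coeffA_pos hk).ne'
  have hδ : (1 + if j = k then 1 else 0 : ℝ) ≠ 0 := by split_ifs <;> norm_num
  have hsgn := neg_one_pow_two_mul_sub ℝ (show j ≤ 2 * k by omega)
  have h2 : Real.sqrt 2 ≠ 0 := by positivity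
  have p0 : (2 : ℝ) ^ (2 * k) = Real.sqrt 2 ^ (4 * (k : ℤ)) := by
    rw [show 4 * (k : ℤ) = 2 * ((2 * k : ℕ) : ℤ) by push_cast; ring, sqrt_two_zpow_two_mul,
      zpow_natCast]
  have p1 : (2 : ℝ) ^ (2 * (k : ℝ) + 1 / 2 - (j : ℝ))
      = 2 ^ (2 * k) * Real.sqrt 2 ^ (1 - 2 * (j : ℤ)) := by
    rw [p0, ← zpow_add₀ h2, ← two_rpow_eq_sqrt_two_zpow]
    congr 1
    push_cast
    ring
  have p2 : (2 : ℝ) ^ ((j : ℝ) + 1 / 2)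
      = 2 ^ (2 * k) * Real.sqrt 2 ^ (1 - 2 * ((2 * k - j : ℕ) : ℤ)) := by
    rw [p0, ← zpow_add₀ h2, ← two_rpow_eq_sqrt_two_zpow]
    congr 1
    rw [Nat.cast_sub (by omega)]
    push_cast
    ring
  have c2 : (2 * ((2 * k - j : ℕ) : ℝ) - 1) * theta7 = (4 * (k : ℝ) - 1 - 2 * (j : ℝ)) * theta7 := by
    rw [Nat.cast_sub (by omega)]
    push_cast
    ring
  rw [coeffC, p1, p2, c2, hsgn]
  field_simp
  ring

lemma sum_cmPoint7_eq {k : ℕ} (hk : 1 ≤ k) :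
    ∑ j ∈ Finset.range (2 * k + 1),
        (cmPoint7 ^ (1 - 2 * (j : ℤ)) - cmPoint7Conj ^ (1 - 2 * (j : ℤ))) *
          ((bernoulli (2 * j) : ℂ) * (bernoulli (4 * k - 2 * j) : ℂ)
          / (((2 * j).factorial : ℂ) * ((4 * k - 2 * j).factorial : ℂ)))
      = -(2 * Complex.I * (coeffA k / 2 ^ (2 * k) : ℝ)) * ∑ j ∈ Finset.range (k + 1),
            (-1) ^ (j + 1) * (coeffC j k : ℂ) * (bernoulli (2 * j) : ℂ)
              * (bernoulli (4 * k - 2 * j) : ℂ)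
              / (((2 * j).factorial : ℂ) * ((4 * k - 2 * j).factorial : ℂ)) := by
  rw [sum_range_fold, Finset.mul_sum]
  refine Finset.sum_congr rfl fun j hj => ?_
  have hj' := Finset.mem_range.1 hj
  have hC := congrArg (fun x : ℝ => (x : ℂ)) (coeffC_eq hk (show j ≤ k by omega))
  simp only [cmPoint7_zpow_sub, sin_odd_mul_pi_div_two_sub]
  rw [show 2 * (2 * k - j) = 4 * k - 2 * j by omega,
    show 4 * k - (4 * k - 2 * j) = 2 * j by omega]
  generalize (bernoulli (2 * j) : ℂ) = B1
  generalize (bernoulli (4 * k - 2 * j) : ℂ) = B2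
  generalize ((2 * j).factorial : ℂ) = F1
  generalize ((4 * k - 2 * j).factorial : ℂ) = F2
  have hite : (((if j = k then 1 else 0 : ℝ)) : ℂ) = if j = k then 1 else 0 := by
    split_ifs <;> simp
  simp only [Complex.ofReal_div, Complex.ofReal_add, Complex.ofReal_mul, Complex.ofReal_neg,
    Complex.ofReal_one, hite, Complex.ofReal_pow, Complex.ofReal_ofNat] at hC ⊢
  linear_combination (2 * Complex.I * (B1 * B2 / (F1 * F2))) * hC

theorem zeta_root7 {k : ℕ} (hk : 1 ≤ k) :
    riemannZeta (4 * (k : ℂ) - 1) =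
      (2 * (Real.pi : ℂ)) ^ (4 * k - 1) *
          ∑ j ∈ Finset.range (k + 1),
            (-1) ^ (j + 1) * (coeffC j k : ℂ) * (bernoulli (2 * j) : ℂ)
              * (bernoulli (4 * k - 2 * j) : ℂ)
              / (((2 * j).factorial : ℂ) * ((4 * k - 2 * j).factorial : ℂ))
        + ((coeffB k / coeffA k : ℝ) : ℂ) * lambertSeries (nome7 1) (-4 * (k : ℂ) + 1)
        - (((((2 : ℝ) ^ (-4 * (k : ℤ) + 2) + 2) * coeffB k - (2 : ℝ) ^ (-2 * (k : ℤ) + 2))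
              / coeffA k : ℝ) : ℂ) * lambertSeries (nome7 2) (-4 * (k : ℂ) + 1)
        + (((2 : ℝ) ^ (-4 * (k : ℤ) + 2) * coeffB k / coeffA k : ℝ) : ℂ)
            * lambertSeries (nome7 4) (-4 * (k : ℂ) + 1) := by
  have hmain := cotSum_cmPoint7 hk
  have hX := cotSum_cmPoint7_eq hk
  have w1 := cotSum_eq_lambertSeries_nome7 hk (m := 1) (by norm_num)
  have w2 := cotSum_eq_lambertSeries_nome7 hk (m := 2) (by norm_num)
  have w4 := cotSum_eq_lambertSeries_nome7 hk (m := 4) (by norm_num)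
  rw [show ((1 : ℕ) : ℂ) * Complex.I * (Real.sqrt 7 : ℝ) / 2
    = Complex.I * (Real.sqrt 7 : ℝ) / 2 by push_cast; ring] at w1
  rw [show ((2 : ℕ) : ℂ) * Complex.I * (Real.sqrt 7 : ℝ) / 2
    = Complex.I * (Real.sqrt 7 : ℝ) by push_cast; ring] at w2
  rw [show ((4 : ℕ) : ℂ) * Complex.I * (Real.sqrt 7 : ℝ) / 2
    = 2 * (Complex.I * (Real.sqrt 7 : ℝ)) by push_cast; ring] at w4
  rw [w1, w2, w4] at hX
  rw [hX, w2, sum_cmPoint7_eq hk, cmPoint7_zpow_add, cos_mul_pi_div_two_sub] at hmain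
  have hA : (coeffA k : ℂ) ≠ 0 := by exact_mod_cast (coeffA_pos hk).ne'
  have r1 : Real.sqrt 2 ^ (2 - 4 * (k : ℤ)) = 2 / 2 ^ (2 * k) := by
    rw [show 2 - 4 * (k : ℤ) = 2 * (1 - (2 * k : ℕ)) by push_cast; ring, sqrt_two_zpow_two_mul,
      zpow_sub₀ two_ne_zero, zpow_one, zpow_natCast]
  have r2 : (2 : ℝ) ^ (-2 * (k : ℤ) + 2) = 4 / 2 ^ (2 * k) := by
    rw [show -2 * (k : ℤ) + 2 = 2 - (2 * k : ℕ) by push_cast; ring, zpow_sub₀ two_ne_zero,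
      zpow_natCast]
    norm_num
  have r3 : (2 : ℝ) ^ (-4 * (k : ℤ) + 2) = 4 / (2 ^ (2 * k)) ^ 2 := by
    rw [show -4 * (k : ℤ) + 2 = 2 - (2 * k * 2 : ℕ) by push_cast; ring, zpow_sub₀ two_ne_zero,
      zpow_natCast, pow_mul]
    norm_num
  have r4 : (2 : ℂ) / 2 ^ (4 * k - 1) = 4 / (2 ^ (2 * k)) ^ 2 := by
    have : ((2 : ℂ) ^ (2 * k)) ^ 2 = 2 ^ (4 * k - 1) * 2 := by
      rw [← pow_succ, ← pow_mul]
      congr 1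
      omega
    rw [this]
    field_simp
    norm_num
  -- This makes `-b_k/2^(2k)` the coefficient of the CM value in the relation `hmain`, while the
  -- coefficient of the zeta value collapses to a multiple of `a_k`.
  have hBA : (coeffB k : ℂ) = 2 * coeffA k + 4 / 2 ^ (2 * k) := by
    have : coeffB k = 2 * coeffA k + 4 / 2 ^ (2 * k) := by
      rw [coeffB_eq, coeffA, r2, pow_succ]; ring
    rw [this]
    push_cast
    rfl
  have hcos : 2 * Real.cos ((4 * (k : ℝ) - 2) * theta7) = coeffA k - 2 ^ (2 * k) := by
    rw [coeffA]; ring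
  have hcos' : 2 * ((2 : ℝ) / 2 ^ (2 * k)) * -Real.cos ((4 * (k : ℝ) - 2) * theta7)
      = -(2 / 2 ^ (2 * k) * (coeffA k - 2 ^ (2 * k))) := by
    rw [← hcos]; ring
  rw [r1, r4, hcos'] at hmain
  rw [r2, r3]
  push_cast at hmain ⊢
  rw [hBA]
  generalize riemannZeta (4 * (k : ℂ) - 1) = Z at *
  generalize lambertSeries (nome7 1) (-4 * (k : ℂ) + 1) = L1 at *
  generalize lambertSeries (nome7 2) (-4 * (k : ℂ) + 1) = L2 at *
  generalize lambertSeries (nome7 4) (-4 * (k : ℂ) + 1) = L4 at *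
  generalize (coeffA k : ℂ) = A at *
  generalize (2 * (Real.pi : ℂ)) ^ (4 * k - 1) = P at *
  have hT : (2 : ℂ) ^ (2 * k) ≠ 0 := pow_ne_zero _ two_ne_zero
  generalize (2 : ℂ) ^ (2 * k) = T at *
  field_simp at hmain ⊢
  linear_combination hmain / 2

/-! ### Asymptotics of Lambert tails. -/

/-- The real Lambert terms `q^n / (n^p (1 - q^n))`, shifted to start at `n = 1`. -/
noncomputable def realLambertTerm (p : ℕ) (q : ℝ) (n : ℕ) : ℝ :=
  q ^ (n + 1) / (((n : ℝ) + 1) ^ p * (1 - q ^ (n + 1)))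

/-- The tail of the real Lambert series after `N` terms. -/
noncomputable def realLambertTail (p : ℕ) (q : ℝ) (N : ℕ) : ℝ :=
  ∑' i : ℕ, realLambertTerm p q (i + N)

/-- The leading order `q^(N+1) / (N+1)^p` of the tail. -/
noncomputable def lambertScale (p : ℕ) (q : ℝ) (N : ℕ) : ℝ :=
  q ^ (N + 1) / ((N : ℝ) + 1) ^ p

lemma lambertScale_pos (p : ℕ) {q : ℝ} (hq : 0 < q) (N : ℕ) : 0 < lambertScale p q N := by
  unfold lambertScale; positivity

lemma one_sub_pow_succ_ge {q : ℝ} (hq : 0 < q) (hq1 : q < 1) (n : ℕ) :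
    1 - q ≤ 1 - q ^ (n + 1) := by
  have : q ^ (n + 1) ≤ q ^ 1 := pow_le_pow_of_le_one hq.le hq1.le (by omega)
  linarith [pow_one q]

lemma tendsto_shift_ratio (p i : ℕ) :
    Tendsto (fun N : ℕ => (((N : ℝ) + 1) / (((i + N : ℕ) : ℝ) + 1)) ^ p) atTop (𝓝 1) := by
  have h : Tendsto (fun N : ℕ => ((N : ℝ) + 1) / (((i + N : ℕ) : ℝ) + 1)) atTop (𝓝 1) := by
    have h1 : Tendsto (fun N : ℕ => 1 - (i : ℝ) * (1 / (((N + i : ℕ) : ℝ) + 1))) atTop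
        (𝓝 (1 - i * 0)) :=
      (((tendsto_add_atTop_iff_nat i).2 tendsto_one_div_add_atTop_nhds_zero_nat).const_mul
        (i : ℝ)).const_sub 1
    rw [mul_zero, sub_zero] at h1
    refine h1.congr fun N => ?_
    have : ((i : ℝ) + N) + 1 ≠ 0 := by positivity
    have : ((N : ℝ) + i) + 1 ≠ 0 := by positivity
    push_cast
    field_simp
    ring
  simpa using h.pow p

/-- After division by the scale, the `i`-th tail term tends to `q^i` and is dominated by
`q^i/(1-q)`. Dominated convergence for series then gives the geometric sum. -/
lemma tendsto_realLambertTail_div (p : ℕ) {q : ℝ} (hq : 0 < q) (hq1 : q < 1) :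
    Tendsto (fun N => realLambertTail p q N / lambertScale p q N) atTop (𝓝 (1 / (1 - q))) := by
  have h1q : 0 < 1 - q := by linarith
  have hq' : ‖q‖ < 1 := by rwa [Real.norm_of_nonneg hq.le]
  have hlim : (1 / (1 - q)) = ∑' i : ℕ, q ^ i := by
    rw [tsum_geometric_of_norm_lt_one hq', one_div]
  simp_rw [hlim, realLambertTail, ← tsum_div_const]
  have hrew : ∀ N i : ℕ, realLambertTerm p q (i + N) / lambertScale p q N
      = q ^ i * (((N : ℝ) + 1) / (((i + N : ℕ) : ℝ) + 1)) ^ p * (1 / (1 - q ^ (i + N + 1))) := by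
    intro N i
    have h := (h1q.trans_le (one_sub_pow_succ_ge hq hq1 (i + N))).ne'
    have h2 : ((i + N : ℕ) : ℝ) + 1 ≠ 0 := by positivity
    have h3 : q ^ (i + N + 1) = q ^ i * q ^ (N + 1) := by rw [← pow_add, add_assoc]
    rw [realLambertTerm, lambertScale, div_pow]
    generalize hd : 1 - q ^ (i + N + 1) = d at *
    rw [h3]
    field_simp
  simp_rw [hrew]
  refine tendsto_tsum_of_dominated_convergence (bound := fun i => q ^ i * (1 / (1 - q)))
    ((summable_geometric_of_lt_one hq.le hq1).mul_right _) (fun i => ?_)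
    (Eventually.of_forall fun N i => ?_)
  · have h1 : Tendsto (fun N : ℕ => q ^ (N + (i + 1))) atTop (𝓝 0) :=
      (tendsto_add_atTop_iff_nat (i + 1)).2 (tendsto_pow_atTop_nhds_zero_of_lt_one hq.le hq1)
    have h2 : Tendsto (fun N : ℕ => 1 / (1 - q ^ (N + (i + 1)))) atTop (𝓝 (1 / (1 - 0))) :=
      tendsto_const_nhds.div (h1.const_sub 1) (by norm_num)
    have h3 := ((tendsto_shift_ratio p i).const_mul (q ^ i)).mul h2
    simp only [mul_one, sub_zero, div_one] at h3
    refine h3.congr fun N => ?_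
    rw [show N + (i + 1) = i + N + 1 by ring]
  · have h := one_sub_pow_succ_ge hq hq1 (i + N)
    have h0 := h1q.trans_le h
    rw [Real.norm_of_nonneg (by positivity)]
    have h2 : (((N : ℝ) + 1) / (((i + N : ℕ) : ℝ) + 1)) ^ p ≤ 1 := by
      refine pow_le_one₀ (by positivity) ?_
      rw [div_le_one (by positivity)]
      push_cast
      linarith [Nat.cast_nonneg (α := ℝ) i]
    calc q ^ i * (((N : ℝ) + 1) / (((i + N : ℕ) : ℝ) + 1)) ^ p * (1 / (1 - q ^ (i + N + 1)))
        ≤ q ^ i * 1 * (1 / (1 - q)) := by gcongr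
      _ = _ := by rw [mul_one]

lemma tendsto_lambertScale_zero (p : ℕ) {q : ℝ} (hq : 0 < q) (hq1 : q < 1) :
    Tendsto (lambertScale p q) atTop (𝓝 0) := by
  refine squeeze_zero (fun N => (lambertScale_pos p hq N).le) (fun N => ?_)
    ((tendsto_add_atTop_iff_nat 1).2 (tendsto_pow_atTop_nhds_zero_of_lt_one hq.le hq1))
  exact div_le_self (by positivity) (one_le_pow₀ (by linarith [Nat.cast_nonneg (α := ℝ) N]))

lemma tendsto_lambertScale_ratio (p : ℕ) {q : ℝ} (hq : 0 < q) :
    Tendsto (fun N => lambertScale p q N / lambertScale p q (N + 1)) atTop (𝓝 (1 / q)) := by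
  have h := ((tendsto_shift_ratio p 1).inv₀ one_ne_zero).mul_const (1 / q)
  rw [inv_one, one_mul] at h
  refine h.congr fun N => ?_
  rw [lambertScale, lambertScale, div_pow]
  have : ((1 + N : ℕ) : ℝ) = ((N + 1 : ℕ) : ℝ) := by rw [add_comm]
  rw [this, pow_succ q (N + 1)]
  field_simp

lemma tendsto_lambertScale_div_lambertScale (p : ℕ) {q q' : ℝ} (hq : 0 < q) (hq' : 0 < q')
    (h : q < q') :
    Tendsto (fun N => lambertScale p q N / lambertScale p q' N) atTop (𝓝 0) := by
  have h1 : Tendsto (fun N : ℕ => (q / q') ^ (N + 1)) atTop (𝓝 0) :=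
    (tendsto_add_atTop_iff_nat 1).2
      (tendsto_pow_atTop_nhds_zero_of_lt_one (by positivity) ((div_lt_one hq').2 h))
  refine h1.congr fun N => ?_
  rw [lambertScale, lambertScale, div_pow]
  field_simp

/-- In the ratio of consecutive errors the constant `c` cancels and the polynomial factor tends to
1, so only `1/q = e^a` survives. -/
lemma hasDigitRate_of_tendsto (p : ℕ) {a c : ℝ} (ha : 0 < a) (hc : 0 < c) {e : ℕ → ℝ}
    (he : Tendsto (fun N => e N / lambertScale p (Real.exp (-a)) N) atTop (𝓝 c)) :
    HasDigitRate e (a / Real.log 10) := by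
  set q := Real.exp (-a) with hq
  have hq0 : 0 < q := Real.exp_pos _
  have hq1 : q < 1 := by rw [hq, Real.exp_lt_one_iff]; linarith
  refine ⟨?_, ?_, ?_⟩
  · filter_upwards [he.eventually (lt_mem_nhds hc)] with N hN
    exact (div_pos_iff_of_pos_right (lambertScale_pos p hq0 N)).1 hN
  · have h := he.mul (tendsto_lambertScale_zero p hq0 hq1)
    rw [mul_zero] at h
    refine h.congr fun N => ?_
    rw [div_mul_cancel₀ _ (lambertScale_pos p hq0 N).ne']
  · have h := (he.mul (((tendsto_add_atTop_iff_nat 1).2 he).inv₀ hc.ne')).mul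
      (tendsto_lambertScale_ratio p hq0)
    rw [mul_inv_cancel₀ hc.ne', one_mul] at h
    have h2 : Tendsto (fun N => e N / e (N + 1)) atTop (𝓝 (1 / q)) := by
      refine h.congr fun N => ?_
      have h1 := (lambertScale_pos p hq0 N).ne'
      have h2 := (lambertScale_pos p hq0 (N + 1)).ne'
      field_simp
    have h3 : Tendsto (fun N => Real.log (e N / e (N + 1)) / Real.log 10) atTop
        (𝓝 (Real.log (1 / q) / Real.log 10)) := (h2.log (by positivity)).div_const _
    have h4 : Real.log (1 / q) = a := by
      rw [one_div, Real.log_inv, hq, Real.log_exp, neg_neg]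
    rw [h4] at h3
    exact h3

lemma lambertTerm_ofReal {k : ℕ} (hk : 1 ≤ k) (q : ℝ) (n : ℕ) :
    lambertTerm (q : ℂ) (-4 * (k : ℂ) + 1) (n + 1) = (realLambertTerm (4 * k - 1) q n : ℝ) := by
  rw [lambertTerm_eq hk, realLambertTerm, div_mul_div_comm, one_mul]
  push_cast
  rfl

lemma lambertSeries_sub_lambertPartial {k : ℕ} (hk : 1 ≤ k) {q : ℝ}
    (hs : Summable fun n : ℕ => lambertTerm (q : ℂ) (-4 * (k : ℂ) + 1) (n + 1)) (N : ℕ) :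
    lambertSeries (q : ℂ) (-4 * (k : ℂ) + 1) - lambertPartial N (q : ℂ) (-4 * (k : ℂ) + 1)
      = (realLambertTail (4 * k - 1) q N : ℝ) := by
  rw [lambertSeries, lambertPartial, ← hs.sum_add_tsum_nat_add N, add_sub_cancel_left,
    realLambertTail, Complex.ofReal_tsum]
  exact tsum_congr fun i => lambertTerm_ofReal hk q (i + N)

/-! ### Leading terms of the two errors. -/

/-- `exp (-m √7 π)` as a real number. -/
noncomputable def realNome7 (m : ℕ) : ℝ := Real.exp (-((m : ℝ) * Real.sqrt 7 * Real.pi))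

lemma realNome7_pos (m : ℕ) : 0 < realNome7 m := Real.exp_pos _

lemma realNome7_lt_one {m : ℕ} (hm : 0 < m) : realNome7 m < 1 := by
  rw [realNome7, Real.exp_lt_one_iff, neg_lt_zero]
  positivity

lemma realNome7_lt {m n : ℕ} (h : m < n) : realNome7 n < realNome7 m := by
  rw [realNome7, realNome7, Real.exp_lt_exp, neg_lt_neg_iff]
  gcongr

lemma tendsto_tail7_div {m : ℕ} (p : ℕ) (hm : 1 < m) :
    Tendsto (fun N => realLambertTail p (realNome7 m) N / lambertScale p (realNome7 1) N)
      atTop (𝓝 0) := by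
  have h := (tendsto_realLambertTail_div p (realNome7_pos _)
    (realNome7_lt_one (m := m) (by omega))).mul
    (tendsto_lambertScale_div_lambertScale p (realNome7_pos _) (realNome7_pos _) (realNome7_lt hm))
  rw [mul_zero] at h
  refine h.congr fun N => ?_
  exact div_mul_div_cancel₀ (lambertScale_pos p (realNome7_pos _) N).ne'

/-- By the exact formula the error is a combination of three tails. Those of the second and fourth
powers of the nome are negligible on the scale of the first, so the limit is governed by `b_k/a_k`.
-/
lemma tendsto_root7Error {k : ℕ} (hk : 1 ≤ k) :
    Tendsto (fun N => root7Error k N / lambertScale (4 * k - 1) (realNome7 1) N) atTop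
      (𝓝 (coeffB k / coeffA k * (1 / (1 - realNome7 1)))) := by
  set p := 4 * k - 1 with hp
  set c2 : ℝ := (((2 : ℝ) ^ (-4 * (k : ℤ) + 2) + 2) * coeffB k - (2 : ℝ) ^ (-2 * (k : ℤ) + 2))
    / coeffA k with hc2
  set c4 : ℝ := (2 : ℝ) ^ (-4 * (k : ℤ) + 2) * coeffB k / coeffA k with hc4
  have hB : 0 < coeffB k / coeffA k := div_pos (coeffB_pos hk) (coeffA_pos hk)
  have hT : ∀ m : ℕ, 0 < m → ∀ N, lambertSeries (nome7 m) (-4 * (k : ℂ) + 1)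
      = lambertPartial N (nome7 m) (-4 * (k : ℂ) + 1) + (realLambertTail p (realNome7 m) N : ℝ) := by
    intro m hm N
    rw [← sub_eq_iff_eq_add']
    exact lambertSeries_sub_lambertPartial hk (summable_lambertTerm_nome7 hk hm) N
  have herr : ∀ N, root7Error k N = |coeffB k / coeffA k * realLambertTail p (realNome7 1) N
      - c2 * realLambertTail p (realNome7 2) N + c4 * realLambertTail p (realNome7 4) N| := by
    intro N
    rw [root7Error, zeta_root7 hk, hT 1 one_pos N, hT 2 two_pos N, hT 4 four_pos N, root7Approx,
      ← hc2, ← hc4, ← Real.norm_eq_abs, ← Complex.norm_real]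
    congr 1
    push_cast
    ring
  have hlim := (((tendsto_realLambertTail_div p (realNome7_pos _)
    (realNome7_lt_one one_pos)).const_mul (coeffB k / coeffA k)).sub
    ((tendsto_tail7_div p one_lt_two).const_mul c2)).add
    ((tendsto_tail7_div (m := 4) p (by norm_num)).const_mul c4)
  have hlim := hlim.abs
  rw [mul_zero, mul_zero, sub_zero, add_zero, abs_of_nonneg (mul_nonneg hB.le
    (one_div_nonneg.2 (sub_nonneg.2 (realNome7_lt_one one_pos).le)))] at hlim
  refine hlim.congr fun N => ?_
  have hs := lambertScale_pos p (realNome7_pos 1) N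
  rw [herr, ← abs_of_pos hs, ← abs_div, abs_of_pos hs]
  congr 1
  ring

lemma tendsto_classicalError {k : ℕ} (hk : 1 ≤ k) :
    Tendsto (fun N => classicalError k N / lambertScale (4 * k - 1) (Real.exp (-(2 * Real.pi))) N)
      atTop (𝓝 (2 * (1 / (1 - Real.exp (-(2 * Real.pi)))))) := by
  set q := Real.exp (-(2 * Real.pi)) with hq
  have hq0 : 0 < q := Real.exp_pos _
  have hq1 : q < 1 := by rw [hq, Real.exp_lt_one_iff]; linarith [Real.pi_pos]
  have hs : Summable fun n : ℕ => lambertTerm (q : ℂ) (-4 * (k : ℂ) + 1) (n + 1) := by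
    have := summable_lambertTerm hk (τ := Complex.I) (by simp)
    rwa [exp_two_pi_I_mul_I] at this
  have herr : ∀ N, classicalError k N = |2 * realLambertTail (4 * k - 1) q N| := by
    intro N
    rw [classicalError, zeta_classical hk, classicalApprox, ← hq, ← Real.norm_eq_abs, ← Complex.norm_real,
      Complex.ofReal_mul, ← lambertSeries_sub_lambertPartial hk hs N, ← norm_neg,
      Complex.ofReal_ofNat]
    congr 1
    ring
  have hlim := ((tendsto_realLambertTail_div (4 * k - 1) hq0 hq1).const_mul 2).abs
  rw [abs_of_nonneg (mul_nonneg zero_le_two (one_div_nonneg.2 (sub_nonneg.2 hq1.le)))] at hlim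
  refine hlim.congr fun N => ?_
  have hs := lambertScale_pos (4 * k - 1) hq0 N
  rw [herr, ← abs_of_pos hs, ← abs_div, abs_of_pos hs]
  congr 1
  ring

/-! ### Numerical bounds. -/

lemma log_ten_lower : 2.287 < Real.log 10 := by
  -- The comparison `2^33 ≤ 10^10` reduces the bound to the known decimals of `log 2`; the upper
  -- bound uses `10^3 ≤ 2^10`.
  have h : Real.log ((2 : ℝ) ^ 33) ≤ Real.log ((10 : ℝ) ^ 10) :=
    Real.log_le_log (by norm_num) (by norm_num)
  rw [Real.log_pow, Real.log_pow] at h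
  push_cast at h
  linarith [Real.log_two_gt_d9]

lemma log_ten_upper : Real.log 10 < 2.311 := by
  have h : Real.log ((10 : ℝ) ^ 3) ≤ Real.log ((2 : ℝ) ^ 10) :=
    Real.log_le_log (by norm_num) (by norm_num)
  rw [Real.log_pow, Real.log_pow] at h
  push_cast at h
  linarith [Real.log_two_lt_d9]

lemma sqrt_seven_lower : 2.6457 < Real.sqrt 7 := Real.lt_sqrt_of_sq_lt (by norm_num)

lemma sqrt_seven_upper : Real.sqrt 7 < 2.6458 :=
  (Real.sqrt_lt' (by norm_num)).2 (by norm_num)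

lemma digit_rate_bound : |Real.sqrt 7 * Real.pi / Real.log 10 - 3.6| < 0.05 := by
  have h1 := log_ten_lower
  have h2 := log_ten_upper
  have h3 := sqrt_seven_lower
  have h4 := sqrt_seven_upper
  have h5 := Real.pi_gt_d4
  have h6 := Real.pi_lt_d4
  have h7 : 2.6457 * 3.1415 ≤ Real.sqrt 7 * Real.pi := by gcongr
  have h8 : Real.sqrt 7 * Real.pi ≤ 2.6458 * 3.1416 := by gcongr
  have hpos : 0 < Real.log 10 := by linarith
  rw [abs_lt]
  constructor
  · rw [lt_sub_iff_add_lt, lt_div_iff₀ hpos]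
    linarith
  · rw [sub_lt_iff_lt_add, div_lt_iff₀ hpos]
    linarith

lemma digit_rate_gain_bound :
    |(Real.sqrt 7 * Real.pi / Real.log 10 - 2 * Real.pi / Real.log 10) - 0.9| < 0.05 := by
  have h1 := log_ten_lower
  have h2 := log_ten_upper
  have h3 := sqrt_seven_lower
  have h4 := sqrt_seven_upper
  have h5 := Real.pi_gt_d4
  have h6 := Real.pi_lt_d4
  have h7 : 2.6457 * 3.1415 ≤ Real.sqrt 7 * Real.pi := by gcongr
  have h8 : Real.sqrt 7 * Real.pi ≤ 2.6458 * 3.1416 := by gcongr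
  have hpos : 0 < Real.log 10 := by linarith
  rw [← sub_div, abs_lt]
  constructor
  · rw [lt_sub_iff_add_lt, lt_div_iff₀ hpos]
    linarith
  · rw [sub_lt_iff_lt_add, div_lt_iff₀ hpos]
    linarith

theorem mainTheorem9 (k : ℕ) (hk : 1 ≤ k) :
    coeffA k ≠ 0 ∧
    (∀ m ∈ ({1, 2, 4} : Set ℕ),
      Summable (fun n : ℕ => lambertTerm (nome7 m) (-4 * (k : ℂ) + 1) (n + 1))) ∧
    riemannZeta (4 * (k : ℂ) - 1) =
      (2 * (Real.pi : ℂ)) ^ (4 * k - 1) *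
          ∑ j ∈ Finset.range (k + 1),
            (-1) ^ (j + 1) * (coeffC j k : ℂ) * (bernoulli (2 * j) : ℂ)
              * (bernoulli (4 * k - 2 * j) : ℂ)
              / (((2 * j).factorial : ℂ) * ((4 * k - 2 * j).factorial : ℂ))
        + ((coeffB k / coeffA k : ℝ) : ℂ) * lambertSeries (nome7 1) (-4 * (k : ℂ) + 1)
        - (((((2 : ℝ) ^ (-4 * (k : ℤ) + 2) + 2) * coeffB k - (2 : ℝ) ^ (-2 * (k : ℤ) + 2))
              / coeffA k : ℝ) : ℂ) * lambertSeries (nome7 2) (-4 * (k : ℂ) + 1)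
        + (((2 : ℝ) ^ (-4 * (k : ℤ) + 2) * coeffB k / coeffA k : ℝ) : ℂ)
            * lambertSeries (nome7 4) (-4 * (k : ℂ) + 1) ∧
    HasDigitRate (root7Error k) (Real.sqrt 7 * Real.pi / Real.log 10) ∧
    HasDigitRate (classicalError k) (2 * Real.pi / Real.log 10) ∧
    Tendsto (fun N => root7Error k N / classicalError k N) atTop (𝓝 0) ∧
    |Real.sqrt 7 * Real.pi / Real.log 10 - 3.6| < 0.05 ∧
    |(Real.sqrt 7 * Real.pi / Real.log 10 - 2 * Real.pi / Real.log 10) - 0.9| < 0.05 := by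
  have hB : 0 < coeffB k / coeffA k := div_pos (coeffB_pos hk) (coeffA_pos hk)
  have hq1 : realNome7 1 < 1 := realNome7_lt_one one_pos
  have hc : 0 < coeffB k / coeffA k * (1 / (1 - realNome7 1)) :=
    mul_pos hB (one_div_pos.2 (sub_pos.2 hq1))
  have hr1 : Real.exp (-(Real.sqrt 7 * Real.pi)) = realNome7 1 := by
    rw [realNome7, Nat.cast_one, one_mul]
  have hq2 : Real.exp (-(2 * Real.pi)) < 1 := by
    rw [Real.exp_lt_one_iff]; linarith [Real.pi_pos]
  have hc2 : 0 < 2 * (1 / (1 - Real.exp (-(2 * Real.pi)))) :=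
    mul_pos two_pos (one_div_pos.2 (sub_pos.2 hq2))
  have h7 := tendsto_root7Error hk
  have h1 := tendsto_classicalError hk
  refine ⟨(coeffA_pos hk).ne', ?_, zeta_root7 hk, ?_, ?_, ?_, digit_rate_bound,
    digit_rate_gain_bound⟩
  · intro m hm
    refine summable_lambertTerm_nome7 hk ?_
    rcases hm with rfl | rfl | rfl <;> norm_num
  · exact hasDigitRate_of_tendsto (4 * k - 1) (by positivity) hc (by rwa [hr1])
  · exact hasDigitRate_of_tendsto (4 * k - 1) (by positivity) hc2 h1
  · have hlt : realNome7 1 < Real.exp (-(2 * Real.pi)) := by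
      rw [← hr1, Real.exp_lt_exp, neg_lt_neg_iff]
      have := sqrt_seven_lower
      have hpi := Real.pi_pos
      gcongr
      linarith
    have h := (h7.mul (h1.inv₀ hc2.ne')).mul (tendsto_lambertScale_div_lambertScale (4 * k - 1)
      (realNome7_pos 1) (Real.exp_pos _) hlt)
    rw [mul_zero] at h
    refine h.congr fun N => ?_
    have e1 := (lambertScale_pos (4 * k - 1) (realNome7_pos 1) N).ne'
    have e2 := (lambertScale_pos (4 * k - 1) (Real.exp_pos (-(2 * Real.pi))) N).ne'
    field_simp
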